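/- **Setting.** Let $d,m,n\in\mathbb N_+$, $r>0$, and let $\Omega=\bigcup_{x\in S}B_r(x)\subset\mathbb R^d$ be the union of the open balls of radius $r$ centred at the points of a bounded set $S$. Let $\mathcal H$ be a real reproducing kernel Hilbert space of functions on $\Omega$ with kernel $k$ and feature map $\phi(x)=k(x,\cdot)$, and let $\mathsf M,\mathsf D_m\ge 1$ be such that (a) $w|_\Omega\in\mathcal H$ for all $w\in C^\infty(\mathbb R^d)$, and $uv\in\mathcal H$ with $\|uv\|_{\mathcal H}\le\mathsf M\|u\|_{\mathcal H}\|v\|_{\mathcal H}$ for all $u,v\in\mathcal H$; (b) $a\circ(v_1,\dots,v_p)\in\mathcal H$ for all $p$, all $a\in C^\infty(\mathbb R^p)$ and all $v_1,\dots,v_p\in\mathcal H$; (c) for every ball $B_\rho(z)\subset\Omega$ and every $u\in\mathcal H$ there is $g\in\mathcal H$ with $g(x)=\int_0^1(1-t)\,u(z+t(x-z))\,dt$ for all $x\in B_\rho(z)$; (d) $k$ is $m$ times continuously differentiable (the derivatives $\partial_x^\alpha\partial_y^\beta k$, $|\alpha|,|\beta|\le m$, exist and are continuous on $\Omega\times\Omega$)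 and $\max_{|\alpha|=m}\sup_{x,y\in\Omega}|\partial_x^\alpha\partial_y^\alpha k(x,y)|\le\mathsf D_m^2$. Let $x_1,\dots,x_n\in\Omega$ be distinct, let $h=\sup_{x\in\Omega}\min_{i}\|x-x_i\|$ be their fill distance, let $R$ be an upper triangular matrix with $R^\top R=(k(x_i,x_j))_{i,j}$ (a Cholesky factor), and let $\Phi_i\in\mathbb R^n$ be the $i$-th column of $R$. Put $$C_0=3\,\frac{\max(\sqrt d,\,3\sqrt{2d}\,(m-1))^{2m}}{m!},\qquad \eta=C_0h^m,$$ let $\lambda>0$, and assume $h\le r/\max(1,18(m-1)^2)$ and $\lambda\ge 2\mathsf M\mathsf D_m\eta$. Let $f:\mathbb R^d\to\mathbb R$, $f_*=\inf_\Omega f$, and $|f|_{\Omega,m}=\max_{|\alpha|=m}\sup_{x\in\Omega}|\partial^\alpha f(x)|$. Consider the problem $$\max_{c\in\mathbb R,\;B\succeq0}\; c-\lambda\operatorname{tr}B\quad\text{such that}\quad f(x_i)-c=\Phi_i^\top B\,\Phi_i\ \ (1\le i\le n),\tag{P}$$ with $B$ ranging over the positive semidefinite real $n\times n$ matrices, and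 denote its optimal value by $p_{\lambda,n}$. For $\theta_1,\theta_2,\tau_1,\tau_2\ge0$, an *approximate solution* of (P) is a pair $(\tilde c,\tilde B)$ with $\tilde c\in\mathbb R$, $\tilde B\succeq0$ and $$p_{\lambda,n}-\tilde c+\lambda\operatorname{tr}\tilde B\le\theta_1+\theta_2\operatorname{tr}\tilde B,\qquad |f(x_i)-\tilde c-\Phi_i^\top\tilde B\,\Phi_i|\le\tau_1+\tau_2\operatorname{tr}\tilde B\quad(1\le i\le n).$$ **Theorem (error of approximate solutions).** 1. Suppose that $f\in C^2(\mathbb R^d)$; that $\Omega$ contains at least one global minimizer of $f$ and only finitely many, the Hessian of $f$ being positive definite at each of them; that there is no global minimizer on $\partial\Omega$; and that $f|_\Omega\in\mathcal H$ and $\frac{\partial^2f}{\partial x_i\partial x_j}\big|_\Omega\in\mathcal H$ for all $i,j$. Then $f_*=\min_{\mathbb R^d}f$, and there is a bounded positive operator $A_*$ on $\mathcal H$, of finite trace and of rank at most $d\,|Z|+1$, where $Z$ is the set of global minimizers of $f$ in $\Omega$, such that $(f_*,A_*)$ maximizes $c$ among all pairs $(c,A)$ of a real number and a bounded positive operator on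 $\mathcal H$ with $f(x)-c=\langle\phi(x),A\phi(x)\rangle$ for all $x\in\Omega$. 2. Let $f$ be any function for which there is a positive trace-class operator $A_*$ on $\mathcal H$ with $f(x)-f_*=\langle\phi(x),A_*\phi(x)\rangle$ for all $x\in\Omega$ (by 1 this is so under the assumptions made there). Then $f\in C^m(\Omega)$ and $|f|_{\Omega,m}<\infty$, the problem (P) admits a solution, and for every such $A_*$, all $\theta_1,\theta_2,\tau_1,\tau_2\ge0$ with $\theta_2,\tau_2\le\lambda/8$, and every approximate solution $(\tilde c,\tilde B)$ of (P) with these parameters, $$|\tilde c-f_*|\le 7\big(2\tau_1+\eta|f|_{\Omega,m}\big)+6\big(\theta_1+\lambda\operatorname{tr}A_*\big),$$ $$\operatorname{tr}\tilde B\le 8\operatorname{tr}A_*+8\,\frac{\eta}{\lambda}\,|f|_{\Omega,m}+8\,\frac{\theta_1+2\tau_1}{\lambda}.$$ -/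

import Mathlib

open scoped ENNReal ContDiff

namespace KernelSOS

noncomputable section

/-- The Euclidean space `ℝ^d`. -/
abbrev E (d : ℕ) : Type := EuclideanSpace ℝ (Fin d)

/-- The partial derivative `∂_{ι 0} ⋯ ∂_{ι (q-1)} u` at `x`. The multi-indices `α` with `|α| = q`
are represented by the tuples `ι : Fin q → Fin d` of coordinates (for functions of class `C^q` the
order of the entries is immaterial), so that a maximum over `|α| = q` is a maximum over `ι`. -/
def partialDeriv {d q : ℕ} (ι : Fin q → Fin d) (u : E d → ℝ) (x : E d) : ℝ :=
  iteratedFDeriv ℝ q u x (fun j => EuclideanSpace.single (ι j) (1 : ℝ))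

/-- The seminorm `|u|_{Ω,m} = max_{|α| = m} sup_{x ∈ Ω} |∂^α u(x)|`. -/
def seminormOn {d : ℕ} (Ω : Set (E d)) (m : ℕ) (u : E d → ℝ) : ℝ :=
  ⨆ ι : Fin m → Fin d, ⨆ x : Ω, |partialDeriv ι u x|

/-- Extension by `0` of a function on `Ω`. It is only used to speak of derivatives and integrals
inside the open set `Ω`, where the values outside `Ω` play no role. -/
def extendZero {d : ℕ} {Ω : Set (E d)} (u : Ω → ℝ) : E d → ℝ :=
  Function.extend Subtype.val u 0

/-- `Ω` is the union of the open balls of radius `r` centred at the points of a bounded set. -/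
def IsUnionOfBalls {d : ℕ} (Ω : Set (E d)) (r : ℝ) : Prop :=
  ∃ S : Set (E d), Bornology.IsBounded S ∧ Ω = ⋃ x ∈ S, Metric.ball x r

/-- The fill distance `h = sup_{z ∈ Ω} min_i ‖z - x_i‖`. -/
def fillDistance {d n : ℕ} {Ω : Set (E d)} (x : Fin n → Ω) : ℝ :=
  ⨆ z : Ω, ⨅ i : Fin n, ‖(z : E d) - x i‖

/-- `z` is a global minimizer of `f` on `ℝ^d`. -/
def IsGlobalMin {d : ℕ} (f : E d → ℝ) (z : E d) : Prop := ∀ y, f z ≤ f y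

/-- Geometric assumptions on `f`. (Being finite, the set of minimizers in `Ω` consists of isolated
points.) -/
structure GeometricAssumption {d : ℕ} (Ω : Set (E d)) (f : E d → ℝ) : Prop where
  contDiff : ContDiff ℝ 2 f
  exists_minimizer : ∃ z ∈ Ω, IsGlobalMin f z
  finite_minimizers : {z ∈ Ω | IsGlobalMin f z}.Finite
  hessian_pos : ∀ z ∈ Ω, IsGlobalMin f z → ∀ v : E d, v ≠ 0 → 0 < iteratedFDeriv ℝ 2 f z ![v, v]
  boundary : ∀ z ∈ frontier Ω, ¬ IsGlobalMin f z

/-- `f_* = inf_Ω f`. -/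
def infOn {d : ℕ} (Ω : Set (E d)) (f : E d → ℝ) : ℝ := ⨅ x : Ω, f x

section RKHS

variable {d : ℕ} {Ω : Set (E d)} (H : Type*) [NormedAddCommGroup H] [InnerProductSpace ℝ H]
  [CompleteSpace H] [RKHS ℝ H Ω ℝ]

/-- The feature map `φ(x) = k(x, ·)`. -/
def feature (x : Ω) : H := RKHS.kerFun H x (1 : ℝ)

/-- The reproducing kernel `k : Ω × Ω → ℝ` of `H`. -/
def ker (x y : Ω) : ℝ := RKHS.kernel H x y (1 : ℝ)

/-- The reproducing kernel, extended by `0` to `ℝ^d × ℝ^d`. -/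
def kerExt (x y : E d) : ℝ := extendZero (fun s : Ω => extendZero (fun t : Ω => ker H s t) y) x

/-- The mixed derivative `∂_x^ι ∂_y^κ k (x, y)`. -/
def kerDeriv {p q : ℕ} (ι : Fin p → Fin d) (κ : Fin q → Fin d) (x y : E d) : ℝ :=
  partialDeriv ι (fun x' => partialDeriv κ (kerExt H x') y) x

/-- The kernel is `m` times continuously differentiable: it is so in each of its two arguments, and
the derivatives `∂_x^α ∂_y^β k`, `|α|, |β| ≤ m`, exist and are continuous on `Ω × Ω`. -/
structure IsKernelOfClass (m : ℕ) : Prop where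
  contDiffOn_right : ∀ x ∈ Ω, ContDiffOn ℝ m (kerExt H x) Ω
  contDiffOn_left : ∀ q ≤ m, ∀ κ : Fin q → Fin d, ∀ y ∈ Ω,
    ContDiffOn ℝ m (fun x => partialDeriv κ (kerExt H x) y) Ω
  continuousOn : ∀ p ≤ m, ∀ q ≤ m, ∀ (ι : Fin p → Fin d) (κ : Fin q → Fin d),
    ContinuousOn (fun z : E d × E d => kerDeriv H ι κ z.1 z.2) (Ω ×ˢ Ω)

/-- Assumptions on the reproducing kernel Hilbert space `H` of functions on `Ω`, with order `m` and
constants `M` and `D`. -/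
structure RichRKHS (m : ℕ) (M D : ℝ) : Prop where
  one_le_M : 1 ≤ M
  smooth_mem : ∀ w : E d → ℝ, ContDiff ℝ ∞ w → ∃ u : H, ∀ x : Ω, u x = w x
  mul_mem : ∀ u v : H, ∃ w : H, (∀ x : Ω, w x = u x * v x) ∧ ‖w‖ ≤ M * ‖u‖ * ‖v‖
  comp_mem : ∀ (p : ℕ) (a : E p → ℝ), ContDiff ℝ ∞ a → ∀ v : Fin p → H,
    ∃ u : H, ∀ x : Ω, u x = a (WithLp.toLp 2 fun j => v j x)
  integral_mem : ∀ (z : E d) (ρ : ℝ), 0 < ρ → Metric.ball z ρ ⊆ Ω → ∀ u : H,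
    ∃ g : H, ∀ x : Ω, (x : E d) ∈ Metric.ball z ρ →
      g x = ∫ t in (0 : ℝ)..1, (1 - t) * extendZero (fun y : Ω => u y) (z + t • ((x : E d) - z))
  one_le_D : 1 ≤ D
  kernel_class : IsKernelOfClass H m
  kernel_bound : ∀ ι : Fin m → Fin d, ∀ x ∈ Ω, ∀ y ∈ Ω, |kerDeriv H ι ι x y| ≤ D ^ 2

/-- Analytic assumptions on `f`: `f|_Ω ∈ C²(Ω) ∩ H` and `(∂_i ∂_j f)|_Ω ∈ H` for all `i, j`. -/
structure AnalyticAssumption (f : E d → ℝ) : Prop where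
  contDiffOn : ContDiffOn ℝ 2 f Ω
  mem : ∃ u : H, ∀ x : Ω, u x = f x
  second_mem : ∀ i j : Fin d, ∃ u : H, ∀ x : Ω, u x = partialDeriv ![i, j] f x

variable {H}

/-- The trace `∑_e ⟨e, A e⟩ ∈ [0, ∞]` of a positive operator `A`, over an orthonormal basis of `H`.
(For positive operators it does not depend on the basis; `A` is trace class iff it is finite.) -/
def posTrace (A : H →L[ℝ] H) : ℝ≥0∞ :=
  ∑' e : (exists_hilbertBasis ℝ H).choose, ENNReal.ofReal (inner ℝ (e : H) (A e))

/-- `(c, A)` is feasible for the infinite-dimensional problem: `A` is a bounded positive operator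
and `f(x) - c = ⟨φ(x), A φ(x)⟩` for all `x ∈ Ω`. -/
def IsFeasible (f : E d → ℝ) (c : ℝ) (A : H →L[ℝ] H) : Prop :=
  A.IsPositive ∧ ∀ x : Ω, f x - c = inner ℝ (feature H x) (A (feature H x))

/-- `(c, A)` is an optimal solution of the infinite-dimensional problem of maximizing `c` over the
feasible pairs. -/
def IsOptimal (f : E d → ℝ) (c : ℝ) (A : H →L[ℝ] H) : Prop :=
  IsFeasible f c A ∧ ∀ (c' : ℝ) (A' : H →L[ℝ] H), IsFeasible f c' A' → c' ≤ c

variable (H) in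
/-- The kernel matrix `K_{ij} = k(x_i, x_j)`. -/
def kernelMatrix {n : ℕ} (x : Fin n → Ω) : Matrix (Fin n) (Fin n) ℝ :=
  Matrix.of fun i j => ker H (x i) (x j)

end RKHS

/-- `R` is a Cholesky factor of `K`: it is upper triangular and `K = Rᵀ R`. (The usual
normalization that the diagonal entries are positive is not needed.) -/
structure IsCholesky {n : ℕ} (K R : Matrix (Fin n) (Fin n) ℝ) : Prop where
  upper : ∀ i j, j < i → R i j = 0
  eq : K = R.transpose * R

/-- The quadratic form `Φ_iᵀ B Φ_i`, where `Φ_i` is the `i`-th column of `R`. -/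
def quadForm {n : ℕ} (R B : Matrix (Fin n) (Fin n) ℝ) (i : Fin n) : ℝ :=
  (fun j => R j i) ⬝ᵥ (B.mulVec fun j => R j i)

/-- The values `c - lam * tr B` of the objective of the finite-dimensional problem at its feasible
points: `B` is positive semidefinite and `f(x_i) - c = Φ_iᵀ B Φ_i` for all `i`. Here `y i = f(x_i)`. -/
def objectiveValues {n : ℕ} (R : Matrix (Fin n) (Fin n) ℝ) (y : Fin n → ℝ) (lam : ℝ) : Set ℝ :=
  {v | ∃ (c : ℝ) (B : Matrix (Fin n) (Fin n) ℝ), B.PosSemidef ∧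
    (∀ i, y i - c = quadForm R B i) ∧ v = c - lam * B.trace}

/-- The optimal value of the finite-dimensional problem. -/
def optimalValue {n : ℕ} (R : Matrix (Fin n) (Fin n) ℝ) (y : Fin n → ℝ) (lam : ℝ) : ℝ :=
  sSup (objectiveValues R y lam)

/-- `(c, B)` is an approximate solution of the finite-dimensional problem with parameters
`θ₁, θ₂` (objective) and `τ₁, τ₂` (constraints). -/
structure IsApproxSolution {n : ℕ} (R : Matrix (Fin n) (Fin n) ℝ) (y : Fin n → ℝ) (lam : ℝ)
    (θ₁ θ₂ τ₁ τ₂ : ℝ) (c : ℝ) (B : Matrix (Fin n) (Fin n) ℝ) : Prop where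
  posSemidef : B.PosSemidef
  objective : optimalValue R y lam - c + lam * B.trace ≤ θ₁ + θ₂ * B.trace
  constraints : ∀ i, |y i - c - quadForm R B i| ≤ τ₁ + τ₂ * B.trace

/-- The constant `C₀ = 3 max(√d, 3 √(2d) (m - 1))^{2m} / m!`. -/
def C₀ (d m : ℕ) : ℝ :=
  3 * (max (√(d : ℝ)) (3 * √(2 * (d : ℝ)) * ((m : ℝ) - 1))) ^ (2 * m) / (m.factorial : ℝ)

end

end KernelSOS

open KernelSOS

namespace KernelSOS

/-! Write `T` for the trace of the approximate solution `B`, `t` for the trace of `A`, `F` for the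
seminorm of `f`. Everything rests on an upper and a lower bound for `c - f_*` in which `T` has
different coefficients.

Upper bound. In an orthonormal family `v` the feature vectors at the samples have the columns of `R`
as coordinates (`exists_orthonormal_feature_eq`). Factoring `B = CᵀC`, the function `W = ∑_l (∑_j
C_{lj} v_j)²` is nonnegative, takes the values `Φ_iᵀ B Φ_i` at the samples and has norm at most `M
T` (`exists_function_of_posSemidef`). Hence `f - c - W` is at most `τ₁ + τ₂ T` at the samples, and
its derivatives of order `m` are at most `F + D M T`. A sampling inequality
(`abs_le_of_abs_sample_le`) makes it small on all of `Ω`, and `W ≥ 0` bounds `c` by `f_*` plus the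
error. Lower bound. Compressing `A` to the span of `v` gives a feasible point of trace at most `t`
(`exists_compression`), so the optimal value is at least `f_* - λ t`.

The sampling inequality compares the function with a Taylor polynomial of degree `m - 1`. By
Markov's inequality a polynomial cannot drop from its maximum on a ball to less than half of it over
the distance to a suitable sample. The derivative bound for `W` needs the feature map to be `C^m`
into `H`. This follows from the kernel alone: inner products of difference quotients are mixed
difference quotients of `k`, so the quotients form a Cauchy family (`exists_hasDerivAt_of_gram`).

For the existence of `A`, write `f - f_*` as a finite sum of squares of elements of `H`; the
operator is then the sum of the corresponding rank one operators. Near a minimizer, Taylor's formula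
gives a quadratic form with coefficients in `H`, and a pointwise Cholesky factorization makes it `d`
squares. Away from the minimizers `f - f_*` is bounded below, so its square root is smooth. Cutoffs
whose squares sum to one join the pieces (`exists_sum_squares`). -/

/-! ### Polynomials on well sampled balls -/

open Polynomial in
/-- Markov's inequality at an endpoint of an interval. -/
theorem abs_derivative_eval_left_le {q : ℝ[X]} {l : ℕ} (hq : q.natDegree ≤ l) {a b S : ℝ}
    (hab : a < b) (hS : 0 < S) (hb : ∀ t ∈ Set.Icc a b, |q.eval t| ≤ S) :
    |q.derivative.eval a| ≤ 2 * (l : ℝ) ^ 2 / (b - a) * S := by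
  have key : ∀ σ : ℝ, |σ| = 1 → σ * q.derivative.eval a ≤ 2 * (l : ℝ) ^ 2 / (b - a) * S := by
    intro σ hσ
    -- The substitution maps `1` to `a` and `-1` to `b`; it reverses orientation, hence the sign of
    -- `σ`.
    set P : ℝ[X] := C (-σ / S) * q.comp (C a + C ((b - a) / 2) * (1 - X)) with hP
    have hdeg : P.degree ≤ l := by
      refine Polynomial.degree_le_of_natDegree_le ?_
      refine (natDegree_C_mul_le _ _).trans (natDegree_comp_le.trans ?_)
      have h1 : (C a + C ((b - a) / 2) * (1 - X)).natDegree ≤ 1 := by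
        refine (natDegree_add_le _ _).trans (max_le (by simp) ?_)
        refine (natDegree_C_mul_le _ _).trans ((natDegree_sub_le _ _).trans (by simp))
      calc _ ≤ l * 1 := Nat.mul_le_mul hq h1
        _ = l := mul_one l
    have hbnd : ∀ x ∈ Set.Icc (-1 : ℝ) 1, |P.eval x| ≤ 1 := by
      rintro x ⟨hx1, hx2⟩
      have hmem : a + (b - a) / 2 * (1 - x) ∈ Set.Icc a b := by
        constructor <;> nlinarith
      have := hb _ hmem
      simp only [hP, eval_mul, eval_C, eval_comp, eval_add, eval_sub, eval_one, eval_X, abs_mul,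
        abs_div, abs_neg, hσ, abs_of_pos hS]
      rw [one_div, ← div_eq_inv_mul, div_le_one hS]
      exact this
    have h := Polynomial.Chebyshev.eval_iterate_derivative_le_of_forall_abs_le_one (k := 1)
      (le_refl (1 : ℝ)) hdeg hbnd
    have e1 : (derivative^[1] P).eval 1 = σ * q.derivative.eval a * ((b - a) / (2 * S)) := by
      simp [hP, derivative_comp]
      field_simp
    have e2 : (derivative^[1] (Polynomial.Chebyshev.T ℝ (l : ℤ))).eval 1 = (l : ℝ) ^ 2 := by
      simpa using Polynomial.Chebyshev.derivative_T_eval_one (R := ℝ) (l : ℤ)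
    rw [e1, e2] at h
    have hba : 0 < b - a := sub_pos.2 hab
    rw [mul_div_assoc', div_le_iff₀ (by positivity)] at h
    rw [div_mul_eq_mul_div, le_div_iff₀ hba]
    linarith
  rw [abs_le]
  constructor
  · have := key (-1) (by simp); linarith
  · have := key 1 (by simp); linarith

-- Markov's inequality on `[t, 6 l²]` for `t ≤ 1` bounds the derivative by `2 l² S / (5 l²)`, which
-- is below `S / 2`.
open Polynomial in
theorem half_le_abs_eval_one {q : ℝ[X]} {l : ℕ} (hl : 1 ≤ l) (hq : q.natDegree ≤ l) {S : ℝ}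
    (hS : 0 < S) (hb : ∀ t ∈ Set.Icc (0 : ℝ) (6 * l ^ 2), |q.eval t| ≤ S)
    (h0 : |q.eval 0| = S) : S / 2 ≤ |q.eval 1| := by
  have hl' : (1 : ℝ) ≤ l ^ 2 := one_le_pow₀ (by exact_mod_cast hl)
  have h := Convex.norm_image_sub_le_of_norm_deriv_le (f := fun t => q.eval t) (s := Set.Icc 0 1)
    (C := S / 2) (x := 0) (y := 1) (fun t _ => q.differentiable t) (fun t ht => ?_)
    (convex_Icc 0 1) (by simp) (by simp)
  · have h1 : |q.eval 1 - q.eval 0| ≤ S / 2 := by simpa using h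
    have h2 := abs_sub_abs_le_abs_sub (q.eval 0) (q.eval 1)
    rw [abs_sub_comm] at h2
    linarith
  · rw [Polynomial.deriv, Real.norm_eq_abs]
    have hlt : t < 6 * (l : ℝ) ^ 2 := by linarith [ht.2]
    refine (abs_derivative_eval_left_le hq hlt hS
      fun s hs => hb s ⟨ht.1.trans hs.1, hs.2⟩).trans ?_
    have hpos : 0 < 6 * (l : ℝ) ^ 2 - t := sub_pos.2 hlt
    rw [div_mul_eq_mul_div, div_le_div_iff₀ hpos two_pos]
    nlinarith [ht.2]

-- Expand in every argument and collect powers of `t`. Being a polynomial along each line is all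
-- that the sampling argument asks of a Taylor polynomial.
open Polynomial in
theorem exists_polynomial_multilinear {F : Type*} [NormedAddCommGroup F] [NormedSpace ℝ F]
    {k : ℕ} (f : ContinuousMultilinearMap ℝ (fun _ : Fin k => F) ℝ) (a b : F) :
    ∃ q : ℝ[X], q.natDegree ≤ k ∧ ∀ t : ℝ, f (fun _ => a + t • b) = q.eval t := by
  classical
  refine ⟨∑ s : Finset (Fin k), C (f (s.piecewise (fun _ => a) fun _ => b)) * X ^ (sᶜ.card),
    ?_, fun t => ?_⟩
  · refine natDegree_sum_le_of_forall_le _ _ fun s _ => ?_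
    refine (natDegree_C_mul_X_pow_le _ _).trans ?_
    simpa using Finset.card_le_univ sᶜ
  · have h := f.map_add_univ (fun _ => a) (fun _ => t • b)
    have e : (fun _ : Fin k => a + t • b) = (fun _ => a) + fun _ => t • b := rfl
    rw [e, h, eval_finsetSum]
    refine Finset.sum_congr rfl fun s _ => ?_
    simp only [eval_mul, eval_C, eval_pow, eval_X]
    have e2 : s.piecewise (fun _ : Fin k => a) (fun _ => t • b)
        = sᶜ.piecewise (fun i => t • (s.piecewise (fun _ => a) fun _ => b) i)
          (s.piecewise (fun _ => a) fun _ => b) := by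
      ext1 i
      by_cases hi : i ∈ s <;> simp [hi]
    rw [e2]
    have h3 := f.toMultilinearMap.map_piecewise_smul (fun _ => t)
      (s.piecewise (fun _ => a) fun _ => b) sᶜ
    simp only [ContinuousMultilinearMap.coe_coe, Finset.prod_const, smul_eq_mul] at h3
    rw [mul_comm, ← h3]

theorem sum_abs_le {d : ℕ} (v : E d) : ∑ i, |v i| ≤ √(d : ℝ) * ‖v‖ := by
  rw [EuclideanSpace.norm_eq, ← Real.sqrt_mul (by positivity)]
  refine Real.le_sqrt_of_sq_le ?_
  have h := sq_sum_le_card_mul_sum_sq (s := (Finset.univ : Finset (Fin d))) (f := fun i => |v i|)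
  simpa using h

theorem eq_sum_single {d : ℕ} (v : E d) : v = ∑ i, v i • EuclideanSpace.single i (1 : ℝ) := by
  ext j
  simp [Finset.sum_apply, Pi.single_apply]

theorem abs_iteratedFDeriv_le {d m : ℕ} {u : E d → ℝ} {y : E d} {N : ℝ}
    (hN : ∀ ι : Fin m → Fin d, |partialDeriv ι u y| ≤ N) (v : E d) :
    |iteratedFDeriv ℝ m u y (fun _ => v)| ≤ (√(d : ℝ) * ‖v‖) ^ m * N := by
  classical
  have hN' : (∑ i, |v i|) ^ m * N ≤ (√(d : ℝ) * ‖v‖) ^ m * N := by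
    rcases Nat.eq_zero_or_pos m with rfl | hm
    · simp
    by_cases hN0 : 0 ≤ N
    · exact mul_le_mul_of_nonneg_right
        (pow_le_pow_left₀ (by positivity) (sum_abs_le v) _) hN0
    -- A negative `N` leaves no tuple at all, so `d = 0` and both sides vanish.
    · have hd : IsEmpty (Fin m → Fin d) := ⟨fun ι => hN0 ((abs_nonneg _).trans (hN ι))⟩
      have : IsEmpty (Fin d) := ⟨fun i => hd.false fun _ => i⟩
      have hd0 : d = 0 := Nat.eq_zero_of_not_pos fun h => this.false ⟨0, h⟩
      subst hd0
      simp
  refine le_trans ?_ hN'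
  have e : (fun _ : Fin m => v) = fun _ => ∑ i, v i • EuclideanSpace.single i (1 : ℝ) :=
    funext fun _ => eq_sum_single v
  rw [e, ContinuousMultilinearMap.map_sum]
  refine (Finset.abs_sum_le_sum_abs _ _).trans ?_
  rw [Fintype.sum_pow, Finset.sum_mul]
  refine Finset.sum_le_sum fun r _ => ?_
  rw [ContinuousMultilinearMap.map_smul_univ, smul_eq_mul, abs_mul, Finset.abs_prod]
  exact mul_le_mul_of_nonneg_left (hN r) (by positivity)

theorem taylor_remainder_le {d m : ℕ} (hm : 0 < m) {Ω : Set (E d)} (hΩ : IsOpen Ω) {g : E d → ℝ}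
    (hg : ContDiffOn ℝ m g Ω) {N : ℝ}
    (hN : ∀ y ∈ Ω, ∀ ι : Fin m → Fin d, |partialDeriv ι g y| ≤ N) {c v : E d}
    (hseg : ∀ t ∈ Set.Icc (0 : ℝ) 1, c + t • v ∈ Ω) :
    |g (c + v) - ∑ k ∈ Finset.range m, (k.factorial : ℝ)⁻¹ *
      iteratedFDeriv ℝ k g c (fun _ => v)| ≤ (√(d : ℝ) * ‖v‖) ^ m / m.factorial * N := by
  obtain ⟨l, rfl⟩ : ∃ l, m = l + 1 := ⟨m - 1, by omega⟩
  have h := map_add_eq_sum_add_integral_iteratedFDeriv (n := l) (f := g) (x := c) (y := v)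
    fun t ht => by
      have := (hg _ (hseg t ht)).contDiffAt (hΩ.mem_nhds (hseg t ht))
      exact_mod_cast this
  simp only [smul_eq_mul] at h
  rw [h, add_sub_cancel_left, abs_mul, abs_of_pos (by positivity)]
  set K := (√(d : ℝ) * ‖v‖) ^ (l + 1) * N with hK
  have hI : |∫ t in (0 : ℝ)..1, (1 - t) ^ l * iteratedFDeriv ℝ (l + 1) g (c + t • v) fun _ => v|
      ≤ ∫ t in (0 : ℝ)..1, (1 - t) ^ l * K := by
    rw [← Real.norm_eq_abs]
    refine intervalIntegral.norm_integral_le_of_norm_le zero_le_one ?_ ?_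
    · refine Filter.Eventually.of_forall fun t ht => ?_
      have ht' : t ∈ Set.Icc (0 : ℝ) 1 := ⟨ht.1.le, ht.2⟩
      rw [norm_mul, Real.norm_of_nonneg (pow_nonneg (by linarith [ht.2]) _), Real.norm_eq_abs]
      exact mul_le_mul_of_nonneg_left (abs_iteratedFDeriv_le (hN _ (hseg t ht')) v)
        (pow_nonneg (by linarith [ht.2]) _)
    · exact (by fun_prop : Continuous fun t : ℝ => (1 - t) ^ l * K).intervalIntegrable _ _
  have e : ∫ t in (0 : ℝ)..1, (1 - t) ^ l * K = K / (l + 1) := by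
    rw [intervalIntegral.integral_mul_const,
      intervalIntegral.integral_comp_sub_left (fun t => t ^ l) 1]
    simp
    ring
  rw [e] at hI
  calc _ ≤ (l.factorial : ℝ)⁻¹ * (K / (l + 1)) := by gcongr
    _ = _ := by
      rw [hK, Nat.factorial_succ]; push_cast; field_simp

/-- From a maximum point `xs` of `|p|` go `2h` along the radius towards the centre and take a sample
`s` within `h` of the point reached. The ray from `xs` through `s` stays in the ball up to the
parameter `T = 6 l²`, so `half_le_abs_eval_one` applies along it and `|p s|` is at least half of the
maximum. The radius is `3h · T` because `s - xs` has length at most `3h`. -/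
theorem abs_le_two_mul_of_sample {d l : ℕ} (hd : 0 < d) (hl : 1 ≤ l) {p : E d → ℝ}
    (hp : Continuous p) (hpoly : ∀ a b : E d, ∃ q : Polynomial ℝ, q.natDegree ≤ l ∧
      ∀ t : ℝ, p (a + t • b) = q.eval t)
    {c : E d} {h : ℝ} (hh : 0 < h) {X : Set (E d)}
    (hX : ∀ y ∈ Metric.ball c (18 * (l : ℝ) ^ 2 * h), ∃ s ∈ X, ‖y - s‖ ≤ h) {B : ℝ}
    (hB : ∀ s ∈ X, s ∈ Metric.closedBall c (18 * (l : ℝ) ^ 2 * h) → |p s| ≤ B)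
    {z : E d} (hz : z ∈ Metric.closedBall c (18 * (l : ℝ) ^ 2 * h)) : |p z| ≤ 2 * B := by
  set T : ℝ := 6 * (l : ℝ) ^ 2 with hT
  have hl' : (1 : ℝ) ≤ (l : ℝ) ^ 2 := one_le_pow₀ (by exact_mod_cast hl)
  have hT6 : 6 ≤ T := by linarith
  have hρ : 18 * (l : ℝ) ^ 2 * h = 3 * h * T := by rw [hT]; ring
  rw [hρ] at hX hB hz
  obtain ⟨xs, hxs, hmax⟩ := (isCompact_closedBall c (3 * h * T)).exists_isMaxOn ⟨z, hz⟩
    hp.abs.continuousOn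
  have hmax' : ∀ y ∈ Metric.closedBall c (3 * h * T), |p y| ≤ |p xs| := fun y hy => hmax hy
  obtain ⟨e, s0, he, hs0, hxe⟩ : ∃ (e : E d) (s0 : ℝ), ‖e‖ = 1 ∧ 0 ≤ s0 ∧ xs - c = s0 • e := by
    by_cases hxc : xs = c
    · exact ⟨EuclideanSpace.single ⟨0, hd⟩ 1, 0, by simp, le_rfl, by simp [hxc]⟩
    · have hne : ‖xs - c‖ ≠ 0 := norm_ne_zero_iff.2 (sub_ne_zero.2 hxc)
      refine ⟨‖xs - c‖⁻¹ • (xs - c), ‖xs - c‖, ?_, norm_nonneg _, ?_⟩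
      · rw [norm_smul, norm_inv, norm_norm, inv_mul_cancel₀ hne]
      · rw [smul_smul, mul_inv_cancel₀ hne, one_smul]
  have hs0' : s0 ≤ 3 * h * T := by
    rw [mem_closedBall_iff_norm, hxe, norm_smul, he, mul_one, Real.norm_of_nonneg hs0] at hxs
    exact hxs
  have hy : xs - (2 * h) • e ∈ Metric.ball c (3 * h * T) := by
    rw [mem_ball_iff_norm]
    have : xs - (2 * h) • e - c = (s0 - 2 * h) • e := by rw [sub_smul, ← hxe]; abel
    rw [this, norm_smul, he, mul_one, Real.norm_eq_abs, abs_lt]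
    constructor <;> nlinarith
  obtain ⟨s, hsX, hs⟩ := hX _ hy
  set w := s - xs with hw
  set δ := w + (2 * h) • e with hδ
  have hδn : ‖δ‖ ≤ h := by
    have : δ = -(xs - (2 * h) • e - s) := by rw [hδ, hw]; abel
    rwa [this, norm_neg]
  set σ := inner ℝ e δ with hσ
  have hσl : |σ| ≤ h := by
    have := abs_real_inner_le_norm e δ
    rw [he, one_mul] at this
    exact this.trans hδn
  have hlin : ∀ t : ℝ, xs + t • w - c = (s0 - 2 * h * t) • e + t • δ := fun t => by
    have h1 : xs + t • w - c = (xs - c) + t • w := by abel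
    have h2 : w = δ - (2 * h) • e := by rw [hδ]; abel
    rw [h1, hxe, h2, smul_sub, sub_smul, smul_smul, mul_comm t]
    abel
  have hin : ∀ t ∈ Set.Icc (0 : ℝ) T, xs + t • w ∈ Metric.closedBall c (3 * h * T) := by
    -- Convexity of the ball reduces the claim to the far end of the ray. The extreme case `s0 = 0`,
    -- `δ = -h e` lands exactly on the sphere.
    have hend : xs + T • w ∈ Metric.closedBall c (3 * h * T) := by
      rw [mem_closedBall_iff_norm, hlin]
      refine abs_le_of_sq_le_sq' ?_ (by positivity) |>.2
      rw [norm_add_sq_real, norm_smul, norm_smul, he, inner_smul_left, inner_smul_right]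
      simp only [Real.norm_eq_abs, mul_one, conj_trivial, mul_pow, sq_abs]
      rw [← hσ]
      have hδ2 : ‖δ‖ ^ 2 ≤ h ^ 2 := pow_le_pow_left₀ (norm_nonneg _) hδn 2
      have hT0 : 0 < T := by linarith
      obtain ⟨h1, h2⟩ := abs_le.1 hσl
      have k1 : T ^ 2 * ‖δ‖ ^ 2 ≤ T ^ 2 * h ^ 2 := by gcongr
      have k2 : s0 * (s0 - 3 * h * T) ≤ 0 :=
        mul_nonpos_of_nonneg_of_nonpos hs0 (by linarith)
      have k3 : 0 ≤ T * (3 * h * T - s0) * (h + σ) :=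
        mul_nonneg (mul_nonneg hT0.le (by linarith)) (by linarith)
      have k4 : 0 ≤ s0 * T * (7 * h - 2 * σ) :=
        mul_nonneg (mul_nonneg hs0 hT0.le) (by linarith)
      nlinarith
    intro t ht
    have hT0 : 0 < T := by linarith
    have : xs + t • w = (1 - t / T) • xs + (t / T) • (xs + T • w) := by
      rw [smul_add, smul_smul, div_mul_cancel₀ _ hT0.ne', sub_smul, one_smul]; abel
    rw [this]
    refine convex_closedBall c _ hxs hend ?_ (by have := ht.1; positivity) (by ring)
    rw [sub_nonneg, div_le_one hT0]; exact ht.2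
  rcases (abs_nonneg (p xs)).eq_or_lt with h0 | hpos
  · have hsB := hB s hsX (by
      have := hin 1 ⟨zero_le_one, by linarith⟩
      rwa [one_smul, hw, add_sub_cancel] at this)
    have := hmax' z hz
    linarith [abs_nonneg (p s)]
  · obtain ⟨q, hqd, hq⟩ := hpoly xs w
    have h1 := half_le_abs_eval_one hl hqd hpos
      (fun t ht => by rw [← hq]; exact hmax' _ (hin t ht)) (by rw [← hq]; simp)
    have hsB := hB s hsX (by
      have := hin 1 ⟨zero_le_one, by linarith⟩
      rwa [one_smul, hw, add_sub_cancel] at this)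
    rw [← hq, one_smul, hw, add_sub_cancel] at h1
    have := hmax' z hz
    linarith

/-! ### Unions of balls, fill distance and the sampling inequality -/

theorem IsUnionOfBalls.isOpen {d : ℕ} {Ω : Set (E d)} {r : ℝ} (h : IsUnionOfBalls Ω r) :
    IsOpen Ω := by
  obtain ⟨S, -, rfl⟩ := h
  exact isOpen_biUnion fun _ _ => Metric.isOpen_ball

theorem IsUnionOfBalls.isBounded {d : ℕ} {Ω : Set (E d)} {r : ℝ} (h : IsUnionOfBalls Ω r) :
    Bornology.IsBounded Ω := by
  obtain ⟨S, hS, rfl⟩ := h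
  refine (hS.cthickening (δ := r)).subset (Set.iUnion₂_subset fun s hs y hy => ?_)
  exact Metric.mem_cthickening_of_dist_le y s r S hs (Metric.mem_ball.1 hy).le

theorem IsUnionOfBalls.exists_ball {d : ℕ} {Ω : Set (E d)} {r : ℝ} (h : IsUnionOfBalls Ω r)
    {z : E d} (hz : z ∈ Ω) : ∃ s, z ∈ Metric.ball s r ∧ Metric.ball s r ⊆ Ω := by
  obtain ⟨S, hS, rfl⟩ := h
  obtain ⟨s, hs, hzs⟩ := Set.mem_iUnion₂.1 hz
  exact ⟨s, hzs, Set.subset_biUnion_of_mem (u := fun s => Metric.ball s r) hs⟩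

theorem fillDistance_nonneg {d n : ℕ} {Ω : Set (E d)} (x : Fin n → Ω) : 0 ≤ fillDistance x :=
  Real.iSup_nonneg fun _ => Real.iInf_nonneg fun _ => norm_nonneg _

theorem exists_norm_sub_le_fillDistance {d n : ℕ} (hn : 0 < n) {Ω : Set (E d)}
    (hΩ : Bornology.IsBounded Ω) (x : Fin n → Ω) {z : E d} (hz : z ∈ Ω) :
    ∃ i, ‖z - x i‖ ≤ fillDistance x := by
  have : Nonempty (Fin n) := ⟨⟨0, hn⟩⟩
  obtain ⟨i, hi⟩ := exists_eq_ciInf_of_finite (f := fun i : Fin n => ‖z - x i‖)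
  refine ⟨i, hi.le.trans ?_⟩
  obtain ⟨C, hC⟩ := Metric.isBounded_iff.1 hΩ
  refine le_ciSup (f := fun z : Ω => ⨅ i : Fin n, ‖(z : E d) - x i‖) ⟨C, ?_⟩ ⟨z, hz⟩
  rintro _ ⟨y, rfl⟩
  refine (ciInf_le ⟨0, ?_⟩ ⟨0, hn⟩).trans ?_
  · rintro _ ⟨j, rfl⟩; exact norm_nonneg _
  · rw [← dist_eq_norm]; exact hC y.2 (x _).2

/-- Moving from a point of a ball towards the centre by a given distance. -/
theorem exists_toward_center {d : ℕ} {s z : E d} {ρ : ℝ} (hρ : 0 ≤ ρ) :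
    ∃ y : E d, ‖z - y‖ ≤ ρ ∧ ‖y - s‖ ≤ max 0 (‖z - s‖ - ρ) := by
  by_cases hle : ‖z - s‖ ≤ ρ
  · exact ⟨s, hle, by simp⟩
  · push Not at hle
    have hpos : 0 < ‖z - s‖ := hρ.trans_lt hle
    refine ⟨s + (1 - ρ / ‖z - s‖) • (z - s), ?_, ?_⟩
    · have : z - (s + (1 - ρ / ‖z - s‖) • (z - s)) = (ρ / ‖z - s‖) • (z - s) := by
        rw [sub_smul, one_smul]; abel
      rw [this, norm_smul, norm_div, norm_norm, div_mul_cancel₀ _ hpos.ne',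
        Real.norm_of_nonneg hρ]
    · rw [add_sub_cancel_left, norm_smul, Real.norm_of_nonneg, sub_mul, one_mul,
        div_mul_cancel₀ _ hpos.ne']
      · exact le_max_right _ _
      · rw [sub_nonneg, div_le_one hpos]; exact hle.le

/-- Samples may lie on the bounding sphere: all of the segment but its end is in the open ball, and
the end is in `Ω` by assumption. -/
theorem segment_mem_of_ball_subset {d : ℕ} {Ω : Set (E d)} {s z w : E d} {r : ℝ}
    (hball : Metric.ball s r ⊆ Ω) (hz : z ∈ Metric.ball s r) (hw : w ∈ Metric.closedBall s r)
    (hwΩ : w ∈ Ω) {t : ℝ} (ht : t ∈ Set.Icc (0 : ℝ) 1) : z + t • (w - z) ∈ Ω := by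
  rcases eq_or_lt_of_le ht.2 with rfl | h1
  · simpa using hwΩ
  · refine hball ?_
    rw [mem_ball_iff_norm] at hz ⊢
    rw [mem_closedBall_iff_norm] at hw
    have : z + t • (w - z) - s = (1 - t) • (z - s) + t • (w - s) := by
      rw [sub_smul, one_smul, smul_sub, smul_sub, smul_sub]; abel
    rw [this]
    refine (norm_add_le _ _).trans_lt ?_
    rw [norm_smul, norm_smul, Real.norm_of_nonneg ht.1, Real.norm_of_nonneg (by linarith)]
    have h2 : t * ‖w - s‖ ≤ t * r := mul_le_mul_of_nonneg_left hw ht.1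
    have h3 : (1 - t) * ‖z - s‖ < (1 - t) * r := mul_lt_mul_of_pos_left hz (by linarith)
    linarith

theorem C₀_nonneg (d : ℕ) (m : ℕ) : 0 ≤ C₀ d m := by
  have : 0 ≤ max (√(d : ℝ)) (3 * √(2 * (d : ℝ)) * ((m : ℝ) - 1)) :=
    (Real.sqrt_nonneg _).trans (le_max_left _ _)
  unfold C₀
  positivity

/-- A sampling inequality: a function that is small at well distributed points is small. -/
theorem abs_le_of_abs_sample_le {d : ℕ} (hd : 0 < d) {Ω : Set (E d)} {r : ℝ}
    (hΩ : IsUnionOfBalls Ω r) {m : ℕ} (hm : 0 < m) {n : ℕ} (hn : 0 < n) (x : Fin n → Ω)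
    (hfill : fillDistance x ≤ r / max 1 (18 * ((m : ℝ) - 1) ^ 2))
    {g : E d → ℝ} (hg : ContDiffOn ℝ m g Ω) {N τ : ℝ}
    (hN : ∀ y ∈ Ω, ∀ ι : Fin m → Fin d, |partialDeriv ι g y| ≤ N)
    (hτ : ∀ i, |g (x i)| ≤ τ) {z : E d} (hz : z ∈ Ω) :
    |g z| ≤ 2 * τ + C₀ d m * fillDistance x ^ m * N := by
  set h := fillDistance x with hh
  have hh0 : 0 ≤ h := fillDistance_nonneg x
  have hsample : ∀ y ∈ Ω, ∃ i, ‖y - x i‖ ≤ h :=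
    fun y hy => exists_norm_sub_le_fillDistance hn hΩ.isBounded x hy
  have hτ0 : 0 ≤ τ := (abs_nonneg _).trans (hτ ⟨0, hn⟩)
  have hN0 : 0 ≤ N := (abs_nonneg _).trans (hN z hz fun _ => ⟨0, hd⟩)
  have hd1 : (1 : ℝ) ≤ √(d : ℝ) := Real.one_le_sqrt.2 (by exact_mod_cast hd)
  have hC := C₀_nonneg d m
  rcases hh0.eq_or_lt with h0 | hpos
  · obtain ⟨i, hi⟩ := hsample z hz
    have : z = x i := by
      rw [← sub_eq_zero, ← norm_le_zero_iff, h0]; exact hi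
    rw [this]
    have : 0 ≤ C₀ d m * h ^ m * N := by positivity
    linarith [hτ i]
  obtain ⟨s, hzs, hball⟩ := hΩ.exists_ball hz
  have hzs' := mem_ball_iff_norm.1 hzs
  rcases Nat.lt_or_ge 1 m with hm2 | hm1
  · obtain ⟨l, rfl⟩ : ∃ l, m = l + 1 := ⟨m - 1, by omega⟩
    have hl : 1 ≤ l := by omega
    have hl' : (1 : ℝ) ≤ (l : ℝ) ^ 2 := one_le_pow₀ (by exact_mod_cast hl)
    have el : ((l + 1 : ℕ) : ℝ) - 1 = l := by push_cast; ring
    rw [el, max_eq_right (by linarith), le_div_iff₀ (by positivity)] at hfill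
    set ρ := 18 * (l : ℝ) ^ 2 * h with hρ
    have hρpos : 0 < ρ := by positivity
    have hρr : ρ ≤ r := by rw [hρ]; linarith
    -- Even for `z` near the boundary there is a ball of radius `ρ` inside `Ω` whose closure
    -- contains `z`; `ρ ≤ r` is the hypothesis on the fill distance.
    obtain ⟨c, hzc, hcs⟩ := exists_toward_center (s := s) (z := z) hρpos.le
    have hcs' : ‖c - s‖ ≤ r - ρ := hcs.trans (max_le (by linarith) (by linarith))
    have hcball : Metric.ball c ρ ⊆ Ω := by
      refine (Metric.ball_subset_ball' ?_).trans hball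
      rw [dist_eq_norm]; linarith
    set p : E d → ℝ := fun y => ∑ k ∈ Finset.range (l + 1), (k.factorial : ℝ)⁻¹ *
      iteratedFDeriv ℝ k g c (fun _ => y - c) with hp
    set ε := (√(d : ℝ) * ρ) ^ (l + 1) / (l + 1).factorial * N with hε
    have herr : ∀ y ∈ Ω, y ∈ Metric.closedBall c ρ → |g y - p y| ≤ ε := by
      intro y hyΩ hy
      have hyn := mem_closedBall_iff_norm.1 hy
      have := taylor_remainder_le hm hΩ.isOpen hg hN (c := c) (v := y - c)
        fun t ht => segment_mem_of_ball_subset hcball (Metric.mem_ball_self hρpos) hy hyΩ ht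
      rw [add_sub_cancel] at this
      refine this.trans ?_
      rw [hε]; gcongr
    have hpc : Continuous p := by
      rw [hp]; fun_prop
    have hpoly : ∀ a b : E d, ∃ q : Polynomial ℝ, q.natDegree ≤ l ∧
        ∀ t : ℝ, p (a + t • b) = q.eval t := by
      intro a b
      choose q hq1 hq2 using fun k : ℕ =>
        exists_polynomial_multilinear (iteratedFDeriv ℝ k g c) (a - c) b
      refine ⟨∑ k ∈ Finset.range (l + 1), Polynomial.C (k.factorial : ℝ)⁻¹ * q k, ?_, ?_⟩
      · refine Polynomial.natDegree_sum_le_of_forall_le _ _ fun k hk => ?_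
        refine (Polynomial.natDegree_C_mul_le _ _).trans ((hq1 k).trans ?_)
        exact Nat.lt_succ_iff.1 (Finset.mem_range.1 hk)
      · intro t
        rw [Polynomial.eval_finsetSum]
        refine Finset.sum_congr rfl fun k _ => ?_
        rw [Polynomial.eval_mul, Polynomial.eval_C, ← hq2]
        have : a + t • b - c = a - c + t • b := by abel
        rw [this]
    have hzmem : z ∈ Metric.closedBall c ρ := by rwa [mem_closedBall_iff_norm]
    have h2 : |p z| ≤ 2 * (τ + ε) := by
      refine abs_le_two_mul_of_sample hd hl hpc hpoly hpos
        (X := Set.range fun i => (x i : E d)) (c := c) ?_ ?_ hzmem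
      · intro y hy
        obtain ⟨i, hi⟩ := hsample y (hcball hy)
        exact ⟨_, ⟨i, rfl⟩, hi⟩
      · rintro _ ⟨i, rfl⟩ hy
        have h3 := herr _ (x i).2 hy
        have h4 := abs_sub_abs_le_abs_sub (p (x i)) (g (x i))
        rw [abs_sub_comm] at h4
        linarith [hτ i]
    have h3 := herr z hz hzmem
    have h4 := abs_sub_abs_le_abs_sub (g z) (p z)
    -- Two `ε` come from the doubled bound on the samples, one from replacing `g` by `p` at `z`:
    -- this is the `3` in `C₀`.
    have h5 : 3 * ε ≤ C₀ d (l + 1) * h ^ (l + 1) * N := by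
      rw [hε, C₀, el, pow_mul]
      set W := max (√(d : ℝ)) (3 * √(2 * (d : ℝ)) * l) with hW
      have hW2 : √(d : ℝ) * (18 * (l : ℝ) ^ 2) ≤ W ^ 2 := by
        have h6 : 3 * √(2 * (d : ℝ)) * l ≤ W := le_max_right _ _
        have h7 : (3 * √(2 * (d : ℝ)) * l) ^ 2 ≤ W ^ 2 := pow_le_pow_left₀ (by positivity) h6 2
        have h8 : (3 * √(2 * (d : ℝ)) * l) ^ 2 = 18 * d * (l : ℝ) ^ 2 := by
          rw [mul_pow, mul_pow, Real.sq_sqrt (by positivity)]; ring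
        have h9 : √(d : ℝ) ≤ d := by
          nlinarith [Real.sq_sqrt (Nat.cast_nonneg d : (0 : ℝ) ≤ d)]
        nlinarith
      have h10 : (√(d : ℝ) * ρ) ^ (l + 1) ≤ (W ^ 2) ^ (l + 1) * h ^ (l + 1) := by
        rw [← mul_pow]
        refine pow_le_pow_left₀ (by positivity) ?_ _
        rw [hρ, ← mul_assoc]
        exact mul_le_mul_of_nonneg_right hW2 hh0
      calc 3 * ((√(d : ℝ) * ρ) ^ (l + 1) / (l + 1).factorial * N)
          ≤ 3 * ((W ^ 2) ^ (l + 1) * h ^ (l + 1) / (l + 1).factorial * N) := by gcongr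
        _ = _ := by ring
    linarith
  -- Here the radius `18 (m - 1)² h` degenerates to zero. Instead, `z` is compared directly with a
  -- sample at distance at most `2h`, joined to it by a segment in `Ω`.
  · obtain rfl : m = 1 := by omega
    have hhr : h ≤ r := by simpa using hfill
    obtain ⟨y, hzy, hys⟩ := exists_toward_center (s := s) (z := z) hh0
    have hys' : ‖y - s‖ ≤ r - h := hys.trans (max_le (by linarith) (by linarith))
    have hyΩ : y ∈ Ω := by
      refine hball (mem_ball_iff_norm.2 ?_); linarith
    obtain ⟨i, hi⟩ := hsample y hyΩ
    have hxi : (x i : E d) ∈ Metric.closedBall s r := by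
      rw [mem_closedBall_iff_norm]
      have := norm_add_le (x i - y) (y - s)
      rw [sub_add_sub_cancel, norm_sub_rev _ y] at this
      linarith
    have hzx : ‖(x i : E d) - z‖ ≤ 2 * h := by
      have := norm_add_le (z - y) (y - x i)
      rw [sub_add_sub_cancel, norm_sub_rev z (x i)] at this
      linarith
    have h1 := taylor_remainder_le hm hΩ.isOpen hg hN (c := z) (v := x i - z)
      fun t ht => segment_mem_of_ball_subset hball hzs hxi (x i).2 ht
    rw [add_sub_cancel] at h1
    simp only [Finset.range_one, Finset.sum_singleton, Nat.factorial_zero, Nat.cast_one, inv_one,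
      one_mul, iteratedFDeriv_zero_apply, pow_one, Nat.factorial_one, div_one] at h1
    have h2 := abs_sub_abs_le_abs_sub (g z) (g (x i))
    rw [abs_sub_comm] at h2
    have h3 : C₀ d 1 = 3 * d := by
      rw [C₀]
      simp [Real.sq_sqrt]
    have h4 : √(d : ℝ) * ‖(x i : E d) - z‖ * N ≤ 3 * d * h * N := by
      refine mul_le_mul_of_nonneg_right ?_ hN0
      have : √(d : ℝ) * ‖(x i : E d) - z‖ ≤ √(d : ℝ) * (2 * h) := by gcongr
      have h9 : √(d : ℝ) ≤ d := by
        nlinarith [Real.sq_sqrt (Nat.cast_nonneg d : (0 : ℝ) ≤ d)]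
      nlinarith
    rw [h3, pow_one]
    linarith [hτ i]

open Filter Topology

/-! ### Mixed differences and differentiable curves in a Hilbert space -/

section MixedDerivatives

theorem exists_mul_deriv_eq_sub {f f' : ℝ → ℝ} {t : ℝ}
    (h : ∀ τ ∈ Set.uIcc 0 t, HasDerivAt f (f' τ) τ) :
    ∃ τ ∈ Set.uIcc 0 t, f t - f 0 = t * f' τ := by
  rcases lt_trichotomy t 0 with ht | rfl | ht
  · rw [Set.uIcc_of_ge ht.le] at h ⊢
    obtain ⟨τ, hτ, e⟩ := exists_hasDerivAt_eq_slope f f' ht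
      (fun τ hτ => (h τ hτ).continuousAt.continuousWithinAt)
      fun τ hτ => h τ (Set.Ioo_subset_Icc_self hτ)
    refine ⟨τ, Set.Ioo_subset_Icc_self hτ, ?_⟩
    rw [e]; field_simp [ht.ne]; ring
  · exact ⟨0, by simp, by simp⟩
  · rw [Set.uIcc_of_le ht.le] at h ⊢
    obtain ⟨τ, hτ, e⟩ := exists_hasDerivAt_eq_slope f f' ht
      (fun τ hτ => (h τ hτ).continuousAt.continuousWithinAt)
      fun τ hτ => h τ (Set.Ioo_subset_Icc_self hτ)
    refine ⟨τ, Set.Ioo_subset_Icc_self hτ, ?_⟩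
    rw [e]; field_simp [ht.ne']; ring

theorem abs_lt_of_mem_uIcc {t τ ε : ℝ} (ht : |t| < ε) (h : τ ∈ Set.uIcc 0 t) : |τ| < ε := by
  have := Set.abs_sub_left_of_mem_uIcc h
  simp only [sub_zero] at this
  exact this.trans_lt ht

variable {a a_t a_st : ℝ → ℝ → ℝ} {ε : ℝ}

/-- The mean value theorem twice: in `t` for the difference `a s - a 0`, then in `s` for `a_t`. -/
theorem exists_mixed_difference_eq
    (ht : ∀ s t, |s| < ε → |t| < ε → HasDerivAt (fun t => a s t) (a_t s t) t)
    (hst : ∀ s t, |s| < ε → |t| < ε → HasDerivAt (fun s => a_t s t) (a_st s t) s)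
    {s t : ℝ} (hs : |s| < ε) (htε : |t| < ε) :
    ∃ σ ∈ Set.uIcc 0 s, ∃ τ ∈ Set.uIcc 0 t,
      a s t - a 0 t - (a s 0 - a 0 0) = s * t * a_st σ τ := by
  have h0 : |(0 : ℝ)| < ε := by simpa using (abs_nonneg s).trans_lt hs
  obtain ⟨τ, hτ, e1⟩ := exists_mul_deriv_eq_sub (f := fun t => a s t - a 0 t)
    (f' := fun t => a_t s t - a_t 0 t) (t := t)
    fun τ hτ => (ht s τ hs (abs_lt_of_mem_uIcc htε hτ)).sub
      (ht 0 τ h0 (abs_lt_of_mem_uIcc htε hτ))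
  have hτ' := abs_lt_of_mem_uIcc htε hτ
  obtain ⟨σ, hσ, e2⟩ := exists_mul_deriv_eq_sub (f := fun s => a_t s τ)
    (f' := fun s => a_st s τ) (t := s)
    fun σ hσ => hst σ τ (abs_lt_of_mem_uIcc hs hσ) hτ'
  refine ⟨σ, hσ, τ, hτ, ?_⟩
  rw [e1, e2]; ring

theorem exists_dist_mixed_difference_le
    (ht : ∀ s t, |s| < ε → |t| < ε → HasDerivAt (fun t => a s t) (a_t s t) t)
    (hst : ∀ s t, |s| < ε → |t| < ε → HasDerivAt (fun s => a_t s t) (a_st s t) s)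
    (hc : ContinuousAt (fun p : ℝ × ℝ => a_st p.1 p.2) (0, 0)) (hε : 0 < ε) {η : ℝ} (hη : 0 < η) :
    ∃ δ > 0, ∀ s t, |s| < δ → |t| < δ →
      |a s t - a 0 t - (a s 0 - a 0 0) - s * t * a_st 0 0| ≤ |s| * |t| * η := by
  obtain ⟨δ, hδ, h⟩ := Metric.continuousAt_iff.1 hc η hη
  refine ⟨min δ ε, lt_min hδ hε, fun s t hs htt => ?_⟩
  obtain ⟨σ, hσ, τ, hτ, e⟩ := exists_mixed_difference_eq ht hst
    (hs.trans_le (min_le_right _ _)) (htt.trans_le (min_le_right _ _))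
  have hb := h (x := (σ, τ)) (by
    rw [Prod.dist_eq, max_lt_iff, Real.dist_eq, Real.dist_eq, sub_zero, sub_zero]
    exact ⟨(abs_lt_of_mem_uIcc hs hσ).trans_le (min_le_left _ _),
      (abs_lt_of_mem_uIcc htt hτ).trans_le (min_le_left _ _)⟩)
  rw [Real.dist_eq] at hb
  rw [e, ← mul_sub, abs_mul, abs_mul]
  exact mul_le_mul_of_nonneg_left hb.le (by positivity)

/-- Schwarz's theorem in the form due to Peano: one mixed derivative gives the other. -/
theorem hasDerivAt_swap {a_s : ℝ → ℝ}
    (ht : ∀ s t, |s| < ε → |t| < ε → HasDerivAt (fun t => a s t) (a_t s t) t)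
    (hst : ∀ s t, |s| < ε → |t| < ε → HasDerivAt (fun s => a_t s t) (a_st s t) s)
    (hs : ∀ t, |t| < ε → HasDerivAt (fun s => a s t) (a_s t) 0)
    (hc : ContinuousAt (fun p : ℝ × ℝ => a_st p.1 p.2) (0, 0)) (hε : 0 < ε) :
    HasDerivAt a_s (a_st 0 0) 0 := by
  rw [hasDerivAt_iff_isLittleO, Asymptotics.isLittleO_iff]
  intro η hη
  obtain ⟨δ, hδ, h⟩ := exists_dist_mixed_difference_le ht hst hc hε hη
  filter_upwards [Metric.ball_mem_nhds (0 : ℝ) (lt_min hδ hε)] with t htt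
  rw [mem_ball_zero_iff, lt_min_iff, Real.norm_eq_abs] at htt
  have hd : HasDerivAt (fun s => a s t - a s 0 - s * (t * a_st 0 0))
      (a_s t - a_s 0 - 1 * (t * a_st 0 0)) 0 :=
    ((hs t htt.2).sub (hs 0 (by simpa using hε))).sub ((hasDerivAt_id 0).mul_const _)
  -- The mixed difference is bounded by `|s|` times a constant, and such a bound passes to the
  -- derivative in `s` at `0`.
  have := hd.le_of_lip' (C := η * |t|) (by positivity) (by
    filter_upwards [Metric.ball_mem_nhds (0 : ℝ) hδ] with s hsδ
    rw [mem_ball_zero_iff, Real.norm_eq_abs] at hsδ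
    have := h s t hsδ htt.1
    rw [Real.norm_eq_abs, Real.norm_eq_abs, sub_zero]
    calc _ = |a s t - a 0 t - (a s 0 - a 0 0) - s * t * a_st 0 0| := by congr 1; ring
      _ ≤ _ := this
      _ = _ := by ring)
  simpa [smul_eq_mul] using this

variable {H : Type*} [NormedAddCommGroup H] [InnerProductSpace ℝ H] [CompleteSpace H]

/-- A curve in a Hilbert space is differentiable if its Gram function has a continuous mixed
derivative. -/
theorem exists_hasDerivAt_of_gram {ψ : ℝ → H}
    (ht : ∀ s t, |s| < ε → |t| < ε → HasDerivAt (fun t => inner ℝ (ψ s) (ψ t)) (a_t s t) t)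
    (hst : ∀ s t, |s| < ε → |t| < ε → HasDerivAt (fun s => a_t s t) (a_st s t) s)
    (hc : ContinuousAt (fun p : ℝ × ℝ => a_st p.1 p.2) (0, 0)) (hε : 0 < ε) :
    ∃ ψ', HasDerivAt ψ ψ' 0 := by
  -- All inner products of difference quotients tend to `a_st 0 0`, so `‖w s - w t‖²` tends to zero.
  -- Its expansion contains four of them, each with error at most `η² / 8`.
  set w : ℝ → H := fun s => s⁻¹ • (ψ (0 + s) - ψ 0) with hw
  have hcau : Cauchy (map w (𝓝[≠] (0 : ℝ))) := by
    rw [Metric.cauchy_iff]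
    refine ⟨inferInstance, fun η hη => ?_⟩
    obtain ⟨δ, hδ, h⟩ := exists_dist_mixed_difference_le (a := fun s t => inner ℝ (ψ s) (ψ t))
      ht hst hc hε (η := η ^ 2 / 8) (by positivity)
    have key : ∀ s t : ℝ, s ≠ 0 → t ≠ 0 → |s| < δ → |t| < δ →
        |inner ℝ (w s) (w t) - a_st 0 0| ≤ η ^ 2 / 8 := by
      intro s t hs0 ht0 hs htt
      have hb := h s t hs htt
      have e : inner ℝ (w s) (w t) - a_st 0 0 = (s * t)⁻¹ *
          (inner ℝ (ψ s) (ψ t) - inner ℝ (ψ 0) (ψ t) - (inner ℝ (ψ s) (ψ 0) - inner ℝ (ψ 0) (ψ 0))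
            - s * t * a_st 0 0) := by
        simp only [hw, zero_add, inner_smul_left, inner_smul_right, inner_sub_left,
          inner_sub_right, conj_trivial]
        field_simp
      rw [e, abs_mul, abs_inv, abs_mul, inv_mul_le_iff₀ (by positivity)]
      exact hb
    refine ⟨w '' (Metric.ball 0 δ ∩ {0}ᶜ), image_mem_map ?_, ?_⟩
    · exact inter_mem (mem_nhdsWithin_of_mem_nhds (Metric.ball_mem_nhds _ hδ)) self_mem_nhdsWithin
    · rintro _ ⟨s, ⟨hs, hs0⟩, rfl⟩ _ ⟨t, ⟨htt, ht0⟩, rfl⟩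
      rw [mem_ball_zero_iff, Real.norm_eq_abs] at hs htt
      have k1 := abs_le.1 (key s s hs0 hs0 hs hs)
      have k2 := abs_le.1 (key s t hs0 ht0 hs htt)
      have k3 := abs_le.1 (key t t ht0 ht0 htt htt)
      rw [dist_eq_norm]
      refine lt_of_pow_lt_pow_left₀ 2 hη.le ?_
      rw [norm_sub_sq_real, ← real_inner_self_eq_norm_sq, ← real_inner_self_eq_norm_sq]
      have : 0 < η ^ 2 := by positivity
      linarith [k1.2, k2.1, k3.2]
  obtain ⟨ψ', hψ'⟩ := CompleteSpace.complete hcau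
  exact ⟨ψ', hasDerivAt_iff_tendsto_slope_zero.2 hψ'⟩

end MixedDerivatives

/-! ### From partial derivatives to Fréchet derivatives -/

section PartialDerivatives

variable {d : ℕ}

theorem hasDerivAt_partialDeriv {q m : ℕ} (hq : q < m) {Ω : Set (E d)} (hΩ : IsOpen Ω)
    {u : E d → ℝ} (hu : ContDiffOn ℝ m u Ω) (ι : Fin q → Fin d) (i : Fin d) {x : E d} {t : ℝ}
    (hx : x + t • EuclideanSpace.single i (1 : ℝ) ∈ Ω) :
    HasDerivAt (fun t : ℝ => partialDeriv ι u (x + t • EuclideanSpace.single i (1 : ℝ)))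
      (partialDeriv (Fin.cons i ι : Fin (q + 1) → Fin d) u
        (x + t • EuclideanSpace.single i (1 : ℝ))) t := by
  set e : E d := EuclideanSpace.single i (1 : ℝ) with he
  have hcd := (hu _ hx).contDiffAt (hΩ.mem_nhds hx)
  have hdiff : DifferentiableAt ℝ (iteratedFDeriv ℝ q u) (x + t • e) :=
    hcd.differentiableAt_iteratedFDeriv (by exact_mod_cast hq)
  have h1 : HasDerivAt (fun t : ℝ => x + t • e) ((1 : ℝ) • e) t :=
    ((hasDerivAt_id t).smul_const e).const_add x
  have h2 := hdiff.hasFDerivAt.comp_hasDerivAt t h1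
  have h3 := (ContinuousMultilinearMap.apply ℝ (fun _ : Fin q => E d) ℝ
    (fun j => EuclideanSpace.single (ι j) (1 : ℝ))).hasFDerivAt.comp_hasDerivAt t h2
  refine HasDerivAt.congr_deriv (f := fun t : ℝ => partialDeriv ι u (x + t • e)) h3 ?_
  change _ = iteratedFDeriv ℝ (q + 1) u (x + t • e) _
  rw [iteratedFDeriv_succ_apply_left, one_smul]
  simp only [Fin.cons_zero, ← he]
  rfl

variable {F : Type*} [NormedAddCommGroup F] [NormedSpace ℝ F]

/-- A function with continuous partial derivatives is differentiable. -/
theorem hasFDerivAt_of_partial {Ω : Set (E d)} (hΩ : IsOpen Ω) {f : E d → F}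
    {f' : Fin d → E d → F}
    (hf : ∀ i, ∀ x ∈ Ω,
      HasDerivAt (fun t : ℝ => f (x + t • EuclideanSpace.single i (1 : ℝ))) (f' i x) 0)
    (hc : ∀ i, ContinuousOn (f' i) Ω) {y : E d} (hy : y ∈ Ω) :
    HasFDerivAt f (∑ i, (EuclideanSpace.proj i : E d →L[ℝ] ℝ).smulRight (f' i y)) y := by
  classical
  rw [hasFDerivAt_iff_isLittleO_nhds_zero, Asymptotics.isLittleO_iff]
  intro η hη
  -- The factor `√d` pays for passing from `∑ |v i|` to `‖v‖`; the `1` keeps the denominator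
  -- positive when `d = 0`.
  set η' := η / (√(d : ℝ) + 1) with hη'
  have hη'0 : 0 < η' := by positivity
  obtain ⟨δ, hδ, hball⟩ : ∃ δ > 0, ∀ z ∈ Metric.ball y δ, z ∈ Ω ∧
      ∀ i, ‖f' i z - f' i y‖ ≤ η' := by
    have h1 : ∀ᶠ z in 𝓝 y, z ∈ Ω ∧ ∀ i, ‖f' i z - f' i y‖ ≤ η' := by
      refine (hΩ.eventually_mem hy).and (eventually_all.2 fun i => ?_)
      have := ((hc i).continuousAt (hΩ.mem_nhds hy)).sub
        (continuousAt_const (y := f' i y))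
      have h2 := this.norm
      refine (h2.eventually_lt (continuousAt_const (y := η')) ?_).mono fun _ h => le_of_lt h
      simpa using hη'0
    obtain ⟨δ, hδ, h⟩ := Metric.eventually_nhds_iff_ball.1 h1
    exact ⟨δ, hδ, h⟩
  have hderiv : ∀ i, ∀ (z : E d) (t : ℝ), z + t • EuclideanSpace.single i (1 : ℝ) ∈ Ω →
      HasDerivAt (fun t : ℝ => f (z + t • EuclideanSpace.single i (1 : ℝ)))
        (f' i (z + t • EuclideanSpace.single i (1 : ℝ))) t := by
    intro i z t hz
    have h1 := hf i _ hz
    have h2 : HasDerivAt (fun s : ℝ => s - t) 1 t := (hasDerivAt_id t).sub_const t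
    have h3 := HasDerivAt.scomp_of_eq t h1 h2 (by simp)
    rw [one_smul] at h3
    convert h3 using 1
    ext s
    simp only [Function.comp]
    rw [add_assoc, ← add_smul, add_sub_cancel]
  -- The coordinates are changed one at a time, with the mean value inequality for each change.
  have step : ∀ s : Finset (Fin d), ∀ v : E d, ∑ i, |v i| < δ →
      ‖f (y + ∑ i ∈ s, v i • EuclideanSpace.single i (1 : ℝ)) - f y - ∑ i ∈ s, v i • f' i y‖
        ≤ η' * ∑ i ∈ s, |v i| := by
    intro s v hv
    induction s using Finset.induction_on with
    | empty => simp
    | insert k s hk ih =>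
      rw [Finset.sum_insert hk, Finset.sum_insert hk, Finset.sum_insert hk]
      set z := y + ∑ i ∈ s, v i • EuclideanSpace.single i (1 : ℝ) with hz
      have hmem : ∀ t ∈ Set.uIcc 0 (v k), z + t • EuclideanSpace.single k (1 : ℝ)
          ∈ Metric.ball y δ := by
        intro t ht
        have ht' := Set.abs_sub_left_of_mem_uIcc ht
        simp only [sub_zero] at ht'
        rw [mem_ball_iff_norm, hz, add_assoc, add_sub_cancel_left]
        refine (norm_add_le _ _).trans_lt (lt_of_le_of_lt ?_ hv)
        calc _ ≤ ∑ i ∈ s, |v i| + |v k| := by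
              refine add_le_add ((norm_sum_le _ _).trans (le_of_eq ?_)) ?_
              · exact Finset.sum_congr rfl fun i _ => by simp [norm_smul]
              · simpa [norm_smul] using ht'
          _ = ∑ i ∈ insert k s, |v i| := by rw [Finset.sum_insert hk, add_comm]
          _ ≤ _ := Finset.sum_le_sum_of_subset_of_nonneg (Finset.subset_univ _)
              fun _ _ _ => abs_nonneg _
      have hmv := Convex.norm_image_sub_le_of_norm_hasDerivWithin_le
        (f := fun t : ℝ => f (z + t • EuclideanSpace.single k (1 : ℝ)) - t • f' k y)
        (f' := fun t => f' k (z + t • EuclideanSpace.single k (1 : ℝ)) - (1 : ℝ) • f' k y)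
        (s := Set.uIcc 0 (v k)) (C := η') (x := 0) (y := v k)
        (fun t ht => ((hderiv k z t (hball _ (hmem t ht)).1).sub
          ((hasDerivAt_id t).smul_const _)).hasDerivWithinAt)
        (fun t ht => by rw [one_smul]; exact (hball _ (hmem t ht)).2 k)
        (convex_uIcc _ _) Set.left_mem_uIcc Set.right_mem_uIcc
      simp only [zero_smul, add_zero, sub_zero, Real.norm_eq_abs] at hmv
      have e : y + (v k • EuclideanSpace.single k (1 : ℝ) +
          ∑ i ∈ s, v i • EuclideanSpace.single i (1 : ℝ))
          = z + v k • EuclideanSpace.single k (1 : ℝ) := by rw [hz]; abel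
      rw [e]
      calc _ = ‖(f (z + v k • EuclideanSpace.single k (1 : ℝ)) - v k • f' k y - f z) +
            (f z - f y - ∑ i ∈ s, v i • f' i y)‖ := by congr 1; abel
        _ ≤ η' * |v k| + η' * ∑ i ∈ s, |v i| := (norm_add_le _ _).trans (add_le_add hmv ih)
        _ = _ := by ring
  filter_upwards [Metric.ball_mem_nhds (0 : E d)
    (show 0 < δ / (√(d : ℝ) + 1) by positivity)] with v hv
  rw [mem_ball_zero_iff, lt_div_iff₀ (by positivity)] at hv
  have hsum := sum_abs_le v
  have h := step Finset.univ v (by nlinarith [norm_nonneg v])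
  rw [← eq_sum_single v] at h
  simp only [FunLike.coe_sum, Finset.sum_apply,
    ContinuousLinearMap.smulRight_apply, PiLp.proj_apply]
  refine h.trans ?_
  calc η' * ∑ i, |v i| ≤ η' * ((√(d : ℝ) + 1) * ‖v‖) := by
        refine mul_le_mul_of_nonneg_left ?_ hη'0.le
        nlinarith [norm_nonneg v]
    _ = η * ‖v‖ := by rw [hη']; field_simp

end PartialDerivatives

/-! ### Smoothness of the feature map -/

section FeatureMap

variable {d : ℕ} {Ω : Set (E d)} (H : Type*) [NormedAddCommGroup H] [InnerProductSpace ℝ H]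
  [CompleteSpace H] [RKHS ℝ H Ω ℝ]

open Classical in
/-- The feature map, extended by `0` to `ℝ^d`. -/
noncomputable def featureExt (x : E d) : H := if h : x ∈ Ω then feature H (⟨x, h⟩ : Ω) else 0

theorem featureExt_coe (x : Ω) : featureExt H (x : E d) = feature H x := by
  simp [featureExt]

variable {H} in
theorem inner_feature (u : H) (x : Ω) : inner ℝ u (feature H x) = u x := by
  simp [feature]

variable {H} in
theorem inner_feature' (u : H) (x : Ω) : inner ℝ (feature H x) u = u x := by
  simp [feature]

theorem inner_feature_feature (x y : Ω) : inner ℝ (feature H x) (feature H y) = ker H x y := by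
  rw [inner_feature', feature, ker, RKHS.kerFun_apply]

theorem extendZero_coe (u : Ω → ℝ) (x : Ω) : extendZero u (x : E d) = u x :=
  Subtype.val_injective.extend_apply _ _ _

theorem extendZero_of_notMem (u : Ω → ℝ) {x : E d} (hx : x ∉ Ω) : extendZero u x = 0 := by
  unfold extendZero
  rw [Function.extend_apply']
  · rfl
  · rintro ⟨y, rfl⟩; exact hx y.2

theorem kerExt_eq (x y : E d) : kerExt H x y = inner ℝ (featureExt H x) (featureExt H y) := by
  unfold kerExt
  by_cases hx : x ∈ Ω
  · by_cases hy : y ∈ Ω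
    · lift x to Ω using hx
      lift y to Ω using hy
      rw [extendZero_coe, extendZero_coe, featureExt_coe, featureExt_coe, inner_feature_feature]
    · lift x to Ω using hx
      rw [extendZero_coe, extendZero_of_notMem _ hy, featureExt, featureExt, dif_neg hy,
        inner_zero_right]
  · rw [extendZero_of_notMem _ hx, featureExt, dif_neg hx, inner_zero_left]

/-- The iterated partial derivatives of the feature map. -/
noncomputable def featureDeriv : (q : ℕ) → (Fin q → Fin d) → E d → H
  | 0, _ => featureExt H
  | q + 1, κ => fun y => deriv (fun t : ℝ =>
      featureDeriv q (Fin.tail κ) (y + t • EuclideanSpace.single (κ 0) (1 : ℝ))) 0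

variable {H} {m : ℕ}

theorem hasDerivAt_kerDeriv_left (hΩ : IsOpen Ω) (hK : IsKernelOfClass H m) {p q : ℕ} (hp : p < m)
    (hq : q ≤ m) (ι : Fin p → Fin d) (κ : Fin q → Fin d) (i : Fin d) {x y : E d} {t : ℝ}
    (hx : x + t • EuclideanSpace.single i (1 : ℝ) ∈ Ω) (hy : y ∈ Ω) :
    HasDerivAt (fun t : ℝ => kerDeriv H ι κ (x + t • EuclideanSpace.single i (1 : ℝ)) y)
      (kerDeriv H (Fin.cons i ι : Fin (p + 1) → Fin d) κ
        (x + t • EuclideanSpace.single i (1 : ℝ)) y) t :=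
  hasDerivAt_partialDeriv hp hΩ (hK.contDiffOn_left q hq κ y hy) ι i hx

theorem continuous_add_smul_single (x : E d) (i : Fin d) :
    Continuous fun t : ℝ => x + t • EuclideanSpace.single i (1 : ℝ) := by fun_prop

theorem exists_forall_add_smul_mem (hΩ : IsOpen Ω) {x : E d} (hx : x ∈ Ω) (i : Fin d) :
    ∃ ε > 0, ∀ t : ℝ, |t| < ε → x + t • EuclideanSpace.single i (1 : ℝ) ∈ Ω := by
  have h : ∀ᶠ t : ℝ in 𝓝 0, x + t • EuclideanSpace.single i (1 : ℝ) ∈ Ω :=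
    (continuous_add_smul_single x i).continuousAt.eventually_mem
      (hΩ.mem_nhds (by simpa using hx))
  obtain ⟨ε, hε, h⟩ := Metric.eventually_nhds_iff_ball.1 h
  exact ⟨ε, hε, fun t ht => h t (by simpa using ht)⟩

theorem tendsto_kerDeriv (hΩ : IsOpen Ω) (hK : IsKernelOfClass H m) {p q : ℕ}
    (hp : p ≤ m) (hq : q ≤ m) (ι : Fin p → Fin d) (κ : Fin q → Fin d) {x y : E d}
    (hx : x ∈ Ω) (hy : y ∈ Ω) {α : Type*} {l : Filter α} {f g : α → E d}
    (hf : Tendsto f l (𝓝 x)) (hg : Tendsto g l (𝓝 y)) :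
    Tendsto (fun z => kerDeriv H ι κ (f z) (g z)) l (𝓝 (kerDeriv H ι κ x y)) := by
  have h1 := hK.continuousOn p hp q hq ι κ
  have h2 : Ω ×ˢ Ω ∈ 𝓝 (x, y) := (hΩ.prod hΩ).mem_nhds (Set.mk_mem_prod hx hy)
  have h3 := (h1.continuousAt h2).tendsto
  have h4 := h3.comp (hf.prodMk_nhds hg)
  exact h4

theorem continuousAt_kerDeriv_line (hΩ : IsOpen Ω) (hK : IsKernelOfClass H m) {p q : ℕ}
    (hp : p ≤ m) (hq : q ≤ m) (ι : Fin p → Fin d) (κ : Fin q → Fin d) (i j : Fin d) {x y : E d}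
    (hx : x ∈ Ω) (hy : y ∈ Ω) :
    ContinuousAt (fun z : ℝ × ℝ => kerDeriv H ι κ (x + z.1 • EuclideanSpace.single i (1 : ℝ))
      (y + z.2 • EuclideanSpace.single j (1 : ℝ))) (0, 0) := by
  have h1 : Tendsto (fun z : ℝ × ℝ => x + z.1 • EuclideanSpace.single i (1 : ℝ)) (𝓝 (0, 0))
      (𝓝 x) := by
    refine Continuous.tendsto' (by fun_prop) _ _ (by simp)
  have h2 : Tendsto (fun z : ℝ × ℝ => y + z.2 • EuclideanSpace.single j (1 : ℝ)) (𝓝 (0, 0))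
      (𝓝 y) := by
    refine Continuous.tendsto' (by fun_prop) _ _ (by simp)
  have h3 := tendsto_kerDeriv hΩ hK hp hq ι κ hx hy h1 h2
  rw [ContinuousAt]
  simpa using h3

/-- In `kerDeriv` the derivatives in `y` are taken first, so a further one has to pass the
derivatives in `x`. Induct on the number of the latter, exchanging one at a time with
`hasDerivAt_swap`. -/
theorem hasDerivAt_kerDeriv_right (hΩ : IsOpen Ω) (hK : IsKernelOfClass H m) {p q : ℕ}
    (hp : p ≤ m) (hq : q < m) (ι : Fin p → Fin d) (κ : Fin q → Fin d) (j : Fin d) {x y : E d}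
    {t : ℝ} (hx : x ∈ Ω) (hy : y + t • EuclideanSpace.single j (1 : ℝ) ∈ Ω) :
    HasDerivAt (fun t : ℝ => kerDeriv H ι κ x (y + t • EuclideanSpace.single j (1 : ℝ)))
      (kerDeriv H ι (Fin.cons j κ : Fin (q + 1) → Fin d) x
        (y + t • EuclideanSpace.single j (1 : ℝ))) t := by
  induction p generalizing x y t with
  | zero => exact hasDerivAt_partialDeriv hq hΩ (hK.contDiffOn_right x hx) κ j hy
  | succ p ih =>
    obtain ⟨i, ι, rfl⟩ : ∃ (i : Fin d) (ι' : Fin p → Fin d), ι = Fin.cons i ι' :=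
      ⟨ι 0, Fin.tail ι, (Fin.cons_self_tail ι).symm⟩
    set e := EuclideanSpace.single j (1 : ℝ) with he
    suffices h : HasDerivAt (fun s : ℝ => kerDeriv H (Fin.cons i ι : Fin (p + 1) → Fin d) κ x
        (y + t • e + s • e)) (kerDeriv H (Fin.cons i ι : Fin (p + 1) → Fin d)
          (Fin.cons j κ : Fin (q + 1) → Fin d) x (y + t • e)) 0 by
      have h2 : HasDerivAt (fun s : ℝ => s - t) 1 t := (hasDerivAt_id t).sub_const t
      have h3 := HasDerivAt.scomp_of_eq t h h2 (by simp)
      rw [one_smul] at h3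
      refine h3.congr_of_eventuallyEq (Eventually.of_forall fun s => ?_)
      simp only [Function.comp]
      rw [add_assoc, ← add_smul, add_sub_cancel]
    generalize y + t • e = y at hy
    obtain ⟨ε₁, hε₁, h1⟩ := exists_forall_add_smul_mem hΩ hx i
    obtain ⟨ε₂, hε₂, h2⟩ := exists_forall_add_smul_mem hΩ hy j
    have := hasDerivAt_swap (ε := min ε₁ ε₂)
      (a := fun s t => kerDeriv H ι κ (x + s • EuclideanSpace.single i (1 : ℝ)) (y + t • e))
      (a_t := fun s t => kerDeriv H ι (Fin.cons j κ : Fin (q + 1) → Fin d)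
        (x + s • EuclideanSpace.single i (1 : ℝ)) (y + t • e))
      (a_st := fun s t => kerDeriv H (Fin.cons i ι : Fin (p + 1) → Fin d)
        (Fin.cons j κ : Fin (q + 1) → Fin d)
        (x + s • EuclideanSpace.single i (1 : ℝ)) (y + t • e))
      (a_s := fun t => kerDeriv H (Fin.cons i ι : Fin (p + 1) → Fin d) κ x (y + t • e))
      (fun s t hs ht => ih (by omega) ι (h1 s (hs.trans_le (min_le_left _ _)))
        (h2 t (ht.trans_le (min_le_right _ _))))
      (fun s t hs ht => hasDerivAt_kerDeriv_left hΩ hK (by omega) hq ι _ i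
        (h1 s (hs.trans_le (min_le_left _ _))) (h2 t (ht.trans_le (min_le_right _ _))))
      (fun t ht => by
        have := hasDerivAt_kerDeriv_left hΩ hK (by omega) hq.le ι κ i (x := x) (t := 0)
          (by simpa using hx) (h2 t (ht.trans_le (min_le_right _ _)))
        simpa using this)
      (continuousAt_kerDeriv_line hΩ hK hp hq _ _ i j hx hy) (lt_min hε₁ hε₂)
    simpa using this

/-- Differentiability below order `Q` is a hypothesis so that the result is available inside the
induction that proves it. -/
theorem inner_featureDeriv_of_hasDerivAt (hΩ : IsOpen Ω) (hK : IsKernelOfClass H m) {Q : ℕ}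
    (hQ : Q ≤ m)
    (hd : ∀ q < Q, ∀ (κ : Fin q → Fin d) (j : Fin d), ∀ y ∈ Ω,
      HasDerivAt (fun t : ℝ => featureDeriv H q κ (y + t • EuclideanSpace.single j (1 : ℝ)))
        (featureDeriv H (q + 1) (Fin.cons j κ) y) 0)
    {p q : ℕ} (hp : p ≤ Q) (hq : q ≤ Q) (ι : Fin p → Fin d) (κ : Fin q → Fin d) {x y : E d}
    (hx : x ∈ Ω) (hy : y ∈ Ω) :
    inner ℝ (featureDeriv H p ι x) (featureDeriv H q κ y) = kerDeriv H ι κ x y := by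
  induction p generalizing x y with
  | zero =>
    induction q generalizing y with
    | zero => exact (kerExt_eq H x y).symm
    | succ q ih =>
      obtain ⟨j, κ, rfl⟩ : ∃ (j : Fin d) (κ' : Fin q → Fin d), κ = Fin.cons j κ' :=
        ⟨κ 0, Fin.tail κ, (Fin.cons_self_tail κ).symm⟩
      have h1 := (innerSL ℝ (featureDeriv H 0 ι x)).hasFDerivAt.comp_hasDerivAt 0
        (hd q (by omega) κ j y hy)
      have h2 := hasDerivAt_kerDeriv_right hΩ hK (Nat.zero_le m) (q := q) (by omega) ι κ j
        (t := 0) hx (by simpa using hy)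
      obtain ⟨ε, hε, h3⟩ := exists_forall_add_smul_mem hΩ hy j
      have h4 := h2.congr_of_eventuallyEq (f₁ := fun t : ℝ => innerSL ℝ (featureDeriv H 0 ι x)
          (featureDeriv H q κ (y + t • EuclideanSpace.single j (1 : ℝ)))) (by
        filter_upwards [Metric.ball_mem_nhds (0 : ℝ) hε] with t ht
        exact ih (by omega) κ (h3 t (by simpa using ht)))
      have := h1.unique h4
      simpa using this
  | succ p ih =>
    obtain ⟨i, ι, rfl⟩ : ∃ (i : Fin d) (ι' : Fin p → Fin d), ι = Fin.cons i ι' :=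
      ⟨ι 0, Fin.tail ι, (Fin.cons_self_tail ι).symm⟩
    have h1 := (innerSL ℝ (featureDeriv H q κ y)).hasFDerivAt.comp_hasDerivAt 0
      (hd p (by omega) ι i x hx)
    have h2 := hasDerivAt_kerDeriv_left hΩ hK (p := p) (by omega) (hq.trans hQ) ι κ i
      (t := 0) (x := x) (by simpa using hx) hy
    obtain ⟨ε, hε, h3⟩ := exists_forall_add_smul_mem hΩ hx i
    have h4 := h2.congr_of_eventuallyEq (f₁ := fun t : ℝ => innerSL ℝ (featureDeriv H q κ y)
        (featureDeriv H p ι (x + t • EuclideanSpace.single i (1 : ℝ)))) (by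
      filter_upwards [Metric.ball_mem_nhds (0 : ℝ) hε] with t ht
      rw [innerSL_apply_apply, real_inner_comm]
      exact ih (by omega) ι (h3 t (by simpa using ht)) hy)
    have := h1.unique h4
    rw [real_inner_comm]
    simpa using this

/-- Strong induction on the order. The lower orders identify the Gram function of `featureDeriv H q
κ` with `kerDeriv H κ κ`, which has a continuous mixed derivative because `q < m`; then
`exists_hasDerivAt_of_gram` applies. -/
theorem hasDerivAt_featureDeriv (hΩ : IsOpen Ω) (hK : IsKernelOfClass H m) {q : ℕ} (hq : q < m)
    (κ : Fin q → Fin d) (j : Fin d) {y : E d} (hy : y ∈ Ω) :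
    HasDerivAt (fun t : ℝ => featureDeriv H q κ (y + t • EuclideanSpace.single j (1 : ℝ)))
      (featureDeriv H (q + 1) (Fin.cons j κ) y) 0 := by
  induction q using Nat.strong_induction_on generalizing j y with
  | _ q ih =>
    have hgram : ∀ {x y : E d}, x ∈ Ω → y ∈ Ω →
        inner ℝ (featureDeriv H q κ x) (featureDeriv H q κ y) = kerDeriv H κ κ x y :=
      fun hx hy => inner_featureDeriv_of_hasDerivAt hΩ hK hq.le
        (fun p hp κ' j' y' hy' => ih p hp (hp.trans hq) κ' j' hy') le_rfl le_rfl κ κ hx hy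
    obtain ⟨ε, hε, h1⟩ := exists_forall_add_smul_mem hΩ hy j
    set e := EuclideanSpace.single j (1 : ℝ) with he
    obtain ⟨ψ', hψ'⟩ := exists_hasDerivAt_of_gram (ε := ε)
      (ψ := fun t : ℝ => featureDeriv H q κ (y + t • e))
      (a_t := fun s t => kerDeriv H κ (Fin.cons j κ : Fin (q + 1) → Fin d) (y + s • e) (y + t • e))
      (a_st := fun s t => kerDeriv H (Fin.cons j κ : Fin (q + 1) → Fin d)
        (Fin.cons j κ : Fin (q + 1) → Fin d) (y + s • e) (y + t • e))
      (fun s t hs ht => by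
        refine (hasDerivAt_kerDeriv_right hΩ hK hq.le hq κ κ j (h1 s hs)
          (h1 t ht)).congr_of_eventuallyEq ?_
        have : {t : ℝ | |t| < ε} ∈ 𝓝 t := (isOpen_lt continuous_abs continuous_const).mem_nhds ht
        filter_upwards [this] with t ht
        exact hgram (h1 s hs) (h1 t ht))
      (fun s t hs ht => hasDerivAt_kerDeriv_left hΩ hK hq hq κ _ j (h1 s hs) (h1 t ht))
      (continuousAt_kerDeriv_line hΩ hK hq hq _ _ j j hy hy) hε
    have : featureDeriv H (q + 1) (Fin.cons j κ) y = ψ' := by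
      simp only [featureDeriv, Fin.tail_cons, Fin.cons_zero]
      exact hψ'.deriv
    rw [this]
    exact hψ'

theorem inner_featureDeriv (hΩ : IsOpen Ω) (hK : IsKernelOfClass H m) {p q : ℕ} (hp : p ≤ m)
    (hq : q ≤ m) (ι : Fin p → Fin d) (κ : Fin q → Fin d) {x y : E d} (hx : x ∈ Ω) (hy : y ∈ Ω) :
    inner ℝ (featureDeriv H p ι x) (featureDeriv H q κ y) = kerDeriv H ι κ x y :=
  inner_featureDeriv_of_hasDerivAt hΩ hK le_rfl
    (fun _ hq κ j _ hy => hasDerivAt_featureDeriv hΩ hK hq κ j hy) hp hq ι κ hx hy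

theorem continuousOn_featureDeriv (hΩ : IsOpen Ω) (hK : IsKernelOfClass H m) {q : ℕ} (hq : q ≤ m)
    (κ : Fin q → Fin d) : ContinuousOn (featureDeriv H q κ) Ω := by
  intro y hy
  refine ContinuousAt.continuousWithinAt ?_
  have h1 := tendsto_kerDeriv hΩ hK hq hq κ κ hy hy tendsto_id tendsto_id
  have h2 := tendsto_kerDeriv hΩ hK hq hq κ κ hy hy tendsto_id (tendsto_const_nhds (x := y))
  have h3 : Tendsto (fun z => kerDeriv H κ κ z z - 2 * kerDeriv H κ κ z y + kerDeriv H κ κ y y)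
      (𝓝 y) (𝓝 0) := by
    have := (h1.sub (h2.const_mul 2)).add_const (kerDeriv H κ κ y y)
    rwa [show kerDeriv H κ κ y y - 2 * kerDeriv H κ κ y y + kerDeriv H κ κ y y = 0 by ring] at this
  have h4 : Tendsto (fun z => ‖featureDeriv H q κ z - featureDeriv H q κ y‖ ^ 2) (𝓝 y) (𝓝 0) := by
    refine h3.congr' ?_
    filter_upwards [hΩ.mem_nhds hy] with z hz
    rw [norm_sub_sq_real, ← real_inner_self_eq_norm_sq, ← real_inner_self_eq_norm_sq,
      inner_featureDeriv hΩ hK hq hq _ _ hz hz, inner_featureDeriv hΩ hK hq hq _ _ hz hy,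
      inner_featureDeriv hΩ hK hq hq _ _ hy hy]
  rw [ContinuousAt, tendsto_iff_norm_sub_tendsto_zero]
  have h5 := h4.sqrt
  simpa [Real.sqrt_sq (norm_nonneg _)] using h5

/-- Induction on the number `j` of remaining derivatives: the partial derivatives are continuous
members of the same family, one order higher. -/
theorem contDiffOn_featureDeriv (hΩ : IsOpen Ω) (hK : IsKernelOfClass H m) (j : ℕ) {q : ℕ}
    (hq : q + j = m) (κ : Fin q → Fin d) : ContDiffOn ℝ j (featureDeriv H q κ) Ω := by
  induction j generalizing q with
  | zero =>
    rw [Nat.cast_zero, contDiffOn_zero]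
    exact continuousOn_featureDeriv hΩ hK (by omega) κ
  | succ j ih =>
    have hF : ∀ y ∈ Ω, HasFDerivAt (featureDeriv H q κ)
        (∑ i, (EuclideanSpace.proj i : E d →L[ℝ] ℝ).smulRight
          (featureDeriv H (q + 1) (Fin.cons i κ) y)) y := fun y hy =>
      hasFDerivAt_of_partial hΩ
        (fun i x hx => hasDerivAt_featureDeriv hΩ hK (by omega) κ i hx)
        (fun i => continuousOn_featureDeriv hΩ hK (by omega) _) hy
    rw [Nat.cast_succ, contDiffOn_succ_iff_fderiv_of_isOpen hΩ]
    refine ⟨fun y hy => (hF y hy).differentiableAt.differentiableWithinAt, by simp, ?_⟩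
    refine ContDiffOn.congr ?_ fun y hy => (hF y hy).fderiv
    refine ContDiffOn.sum fun i _ => ?_
    exact ((ContinuousLinearMap.smulRightL ℝ (E d) H
      (EuclideanSpace.proj i : E d →L[ℝ] ℝ)).contDiff).comp_contDiffOn (ih (by omega) _)

theorem contDiffOn_featureExt (hΩ : IsOpen Ω) (hK : IsKernelOfClass H m) :
    ContDiffOn ℝ m (featureExt H : E d → H) Ω :=
  contDiffOn_featureDeriv (H := H) hΩ hK m (zero_add m) Fin.elim0

end FeatureMap

/-! ### Bounds for derivatives of functions in `H` and of quadratic forms -/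

section DerivativeBounds

variable {d : ℕ} {Ω : Set (E d)} {H : Type*} [NormedAddCommGroup H] [InnerProductSpace ℝ H]
  [CompleteSpace H] [RKHS ℝ H Ω ℝ] {m : ℕ}

theorem contDiffAt_featureExt (hΩ : IsOpen Ω) (hK : IsKernelOfClass H m) {x : E d} (hx : x ∈ Ω) :
    ContDiffAt ℝ m (featureExt H : E d → H) x :=
  (contDiffOn_featureExt hΩ hK x hx).contDiffAt (hΩ.mem_nhds hx)

theorem partialDeriv_inner_featureExt (hΩ : IsOpen Ω) (hK : IsKernelOfClass H m) {q : ℕ}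
    (hq : q ≤ m) (ι : Fin q → Fin d) (v : H) {x : E d} (hx : x ∈ Ω) :
    partialDeriv ι (fun y => inner ℝ v (featureExt H y)) x =
      inner ℝ v (iteratedFDeriv ℝ q (featureExt H : E d → H) x
        fun j => EuclideanSpace.single (ι j) (1 : ℝ)) := by
  have h := (innerSL ℝ v).iteratedFDeriv_comp_left (contDiffAt_featureExt hΩ hK hx) (i := q)
    (by exact_mod_cast hq)
  exact congrArg (fun T => T fun j => EuclideanSpace.single (ι j) (1 : ℝ)) h

/-- Differentiating `⟨φ(x'), φ(y)⟩` in `y` puts the derivative on one factor, differentiating in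
`x'` puts it on the other. For order `m` this turns the kernel bound into the bound `D` for
derivatives of `φ`. -/
theorem norm_sq_iteratedFDeriv_featureExt (hΩ : IsOpen Ω) (hK : IsKernelOfClass H m) {q : ℕ}
    (hq : q ≤ m) (ι : Fin q → Fin d) {x : E d} (hx : x ∈ Ω) :
    ‖iteratedFDeriv ℝ q (featureExt H : E d → H) x
        fun j => EuclideanSpace.single (ι j) (1 : ℝ)‖ ^ 2 = kerDeriv H ι ι x x := by
  set w := iteratedFDeriv ℝ q (featureExt H : E d → H) x
    fun j => EuclideanSpace.single (ι j) (1 : ℝ) with hw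
  have h1 : (fun x' => partialDeriv ι (kerExt H x') x) =
      fun x' => inner ℝ w (featureExt H x') := by
    ext x'
    have : kerExt H x' = fun y => inner ℝ (featureExt H x') (featureExt H y) :=
      funext fun y => kerExt_eq H x' y
    rw [this, partialDeriv_inner_featureExt hΩ hK hq ι _ hx, real_inner_comm]
  unfold kerDeriv
  rw [h1, partialDeriv_inner_featureExt hΩ hK hq ι _ hx, real_inner_self_eq_norm_sq]

theorem norm_iteratedFDeriv_featureExt_single_le (hΩ : IsOpen Ω) {M D : ℝ} (hH : RichRKHS H m M D)
    (ι : Fin m → Fin d) {x : E d} (hx : x ∈ Ω) :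
    ‖iteratedFDeriv ℝ m (featureExt H : E d → H) x
        fun j => EuclideanSpace.single (ι j) (1 : ℝ)‖ ≤ D := by
  have h0 : 0 ≤ D := zero_le_one.trans hH.one_le_D
  refine abs_le_of_sq_le_sq' ?_ h0 |>.2
  rw [norm_sq_iteratedFDeriv_featureExt hΩ hH.kernel_class le_rfl ι hx]
  exact (le_abs_self _).trans (hH.kernel_bound ι x hx x hx)

theorem contDiffOn_inner_featureExt (hΩ : IsOpen Ω) (hK : IsKernelOfClass H m) (v : H) :
    ContDiffOn ℝ m (fun y => inner ℝ v (featureExt H y)) Ω :=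
  (innerSL ℝ v).contDiff.comp_contDiffOn (contDiffOn_featureExt hΩ hK)

theorem abs_partialDeriv_inner_featureExt_le (hΩ : IsOpen Ω) {M D : ℝ} (hH : RichRKHS H m M D)
    (ι : Fin m → Fin d) (v : H) {x : E d} (hx : x ∈ Ω) :
    |partialDeriv ι (fun y => inner ℝ v (featureExt H y)) x| ≤ D * ‖v‖ := by
  rw [partialDeriv_inner_featureExt hΩ hH.kernel_class le_rfl ι v hx, mul_comm]
  refine (abs_real_inner_le_norm _ _).trans ?_
  gcongr
  exact norm_iteratedFDeriv_featureExt_single_le hΩ hH ι hx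

theorem norm_multilinear_le {F : Type*} [NormedAddCommGroup F] [NormedSpace ℝ F]
    (T : ContinuousMultilinearMap ℝ (fun _ : Fin m => E d) F) {D : ℝ} (hD : 0 ≤ D)
    (hT : ∀ ι : Fin m → Fin d, ‖T fun j => EuclideanSpace.single (ι j) (1 : ℝ)‖ ≤ D) :
    ‖T‖ ≤ Fintype.card (Fin m → Fin d) * D := by
  classical
  refine T.opNorm_le_bound (by positivity) fun v => ?_
  have e : v = fun j => ∑ i, v j i • EuclideanSpace.single i (1 : ℝ) :=
    funext fun j => eq_sum_single (v j)
  conv_lhs => rw [e]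
  rw [ContinuousMultilinearMap.map_sum]
  refine (norm_sum_le _ _).trans ?_
  have : ∀ r : Fin m → Fin d, ‖T fun j => v j (r j) • EuclideanSpace.single (r j) (1 : ℝ)‖
      ≤ D * ∏ j, ‖v j‖ := by
    intro r
    rw [ContinuousMultilinearMap.map_smul_univ, norm_smul, norm_prod, mul_comm]
    refine mul_le_mul (hT r) ?_ (by positivity) hD
    exact Finset.prod_le_prod (fun _ _ => norm_nonneg _) fun j _ => PiLp.norm_apply_le _ _
  refine (Finset.sum_le_sum fun r _ => this r).trans (le_of_eq ?_)
  rw [Finset.sum_const, nsmul_eq_mul, Finset.card_univ]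
  ring

/-- Only order `m` is bounded by assumption, so descend from there. At the centres of the balls the
lower derivatives are bounded because `closure S` is a compact subset of `Ω`; inside each ball the
mean value inequality controls the change. -/
theorem exists_norm_iteratedFDeriv_featureExt_le {r : ℝ} (hΩ : IsUnionOfBalls Ω r) (hr : 0 < r)
    {M D : ℝ} (hH : RichRKHS H m M D) (k : ℕ) {j : ℕ} (hj : j + k = m) :
    ∃ C, 0 ≤ C ∧ ∀ x ∈ Ω, ‖iteratedFDeriv ℝ j (featureExt H : E d → H) x‖ ≤ C := by
  have hD : 0 ≤ D := zero_le_one.trans hH.one_le_D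
  have hO := hΩ.isOpen
  have hcd := contDiffOn_featureExt hO hH.kernel_class
  induction k generalizing j with
  | zero =>
    obtain rfl : j = m := by omega
    exact ⟨_, by positivity, fun x hx => norm_multilinear_le _ hD
      fun ι => norm_iteratedFDeriv_featureExt_single_le hO hH ι hx⟩
  | succ k ih =>
    obtain ⟨C, hC, h⟩ := ih (j := j + 1) (by omega)
    obtain ⟨S, hS, hSΩ⟩ := id hΩ
    have hball : ∀ s ∈ S, Metric.ball s r ⊆ Ω := fun s hs => by
      rw [hSΩ]; exact Set.subset_biUnion_of_mem (u := fun s => Metric.ball s r) hs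
    have hcl : closure S ⊆ Ω := by
      intro s hs
      obtain ⟨t, ht, hst⟩ := Metric.mem_closure_iff.1 hs r hr
      exact hball t ht hst
    have hcont : ContinuousOn (iteratedFDeriv ℝ j (featureExt H : E d → H)) (closure S) := by
      intro y hy
      exact ((contDiffAt_featureExt hO hH.kernel_class (hcl hy)).continuousAt_iteratedFDeriv
        (by exact_mod_cast (by omega : j ≤ m))).continuousWithinAt
    obtain ⟨C', hC'⟩ := hS.isCompact_closure.exists_bound_of_continuousOn hcont
    refine ⟨max C' 0 + C * r, by positivity, fun x hx => ?_⟩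
    rw [hSΩ] at hx
    obtain ⟨s, hs, hxs⟩ := Set.mem_iUnion₂.1 hx
    have hmv := (convex_ball s r).norm_image_sub_le_of_norm_fderiv_le (𝕜 := ℝ)
      (f := iteratedFDeriv ℝ j (featureExt H : E d → H)) (C := C) (x := s) (y := x)
      (fun y hy => (contDiffAt_featureExt hO hH.kernel_class
        (hball s hs hy)).differentiableAt_iteratedFDeriv
          (by exact_mod_cast (by omega : j < m)))
      (fun y hy => by rw [norm_fderiv_iteratedFDeriv]; exact h y (hball s hs hy))
      (Metric.mem_ball_self hr) hxs
    have h1 := norm_add_le (iteratedFDeriv ℝ j (featureExt H : E d → H) x -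
      iteratedFDeriv ℝ j (featureExt H : E d → H) s)
      (iteratedFDeriv ℝ j (featureExt H : E d → H) s)
    rw [sub_add_cancel] at h1
    have h2 := hC' s (subset_closure hs)
    have h3 : ‖x - s‖ ≤ r := (mem_ball_iff_norm.1 hxs).le
    have h4 : C * ‖x - s‖ ≤ C * r := by gcongr
    linarith [le_max_left C' 0]

theorem contDiffOn_quadratic (hΩ : IsOpen Ω) (hK : IsKernelOfClass H m) (A : H →L[ℝ] H) :
    ContDiffOn ℝ m (fun y => inner ℝ (featureExt H y) (A (featureExt H y))) Ω :=
  (contDiffOn_featureExt hΩ hK).inner ℝ (A.contDiff.comp_contDiffOn (contDiffOn_featureExt hΩ hK))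

theorem abs_partialDeriv_le_norm (ι : Fin m → Fin d) (u : E d → ℝ) (x : E d) :
    |partialDeriv ι u x| ≤ ‖iteratedFDeriv ℝ m u x‖ := by
  have := (iteratedFDeriv ℝ m u x).le_opNorm fun j => EuclideanSpace.single (ι j) (1 : ℝ)
  simpa [partialDeriv] using this

/-- Leibniz' rule involves all orders up to `m`. The size of the constant is irrelevant, since it
only serves to show that the seminorm of `f` is finite. -/
theorem exists_abs_partialDeriv_quadratic_le {r : ℝ} (hΩ : IsUnionOfBalls Ω r) (hr : 0 < r)
    {M D : ℝ} (hH : RichRKHS H m M D) (A : H →L[ℝ] H) :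
    ∃ C, ∀ ι : Fin m → Fin d, ∀ x ∈ Ω,
      |partialDeriv ι (fun y => inner ℝ (featureExt H y) (A (featureExt H y))) x| ≤ C := by
  have hO := hΩ.isOpen
  have hcd := contDiffOn_featureExt hO hH.kernel_class
  choose! C hC0 hC using fun (j : ℕ) (hj : j ≤ m) =>
    exists_norm_iteratedFDeriv_featureExt_le hΩ hr hH (m - j) (j := j) (by omega)
  refine ⟨‖innerSL ℝ (E := H)‖ * ∑ i ∈ Finset.range (m + 1), (m.choose i : ℝ) * C i *
    (‖A‖ * C (m - i)), fun ι x hx => (abs_partialDeriv_le_norm ι _ x).trans ?_⟩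
  have h1 := (innerSL ℝ (E := H)).norm_iteratedFDerivWithin_le_of_bilinear
    (f := featureExt H) (g := fun y => A (featureExt H y)) hcd
    (A.contDiff.comp_contDiffOn hcd) hO.uniqueDiffOn hx (n := m) le_rfl
  rw [iteratedFDerivWithin_of_isOpen m hO hx] at h1
  refine h1.trans ?_
  gcongr with i hi
  · exact mul_nonneg (Nat.cast_nonneg _) (hC0 i (by have := Finset.mem_range.1 hi; omega))
  · rw [iteratedFDerivWithin_of_isOpen i hO hx]
    exact hC i (by have := Finset.mem_range.1 hi; omega) x hx
  · rw [iteratedFDerivWithin_of_isOpen _ hO hx]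
    have h2 := A.iteratedFDeriv_comp_left (contDiffAt_featureExt hO hH.kernel_class hx)
      (i := m - i) (by exact_mod_cast Nat.sub_le m i)
    have h3 : iteratedFDeriv ℝ (m - i) (fun y => A (featureExt H y)) x =
      A.compContinuousMultilinearMap (iteratedFDeriv ℝ (m - i) (featureExt H) x) := h2
    rw [h3]
    refine (ContinuousLinearMap.norm_compContinuousMultilinearMap_le _ _).trans ?_
    gcongr
    exact hC _ (Nat.sub_le m i) x hx

theorem partialDeriv_congr (hΩ : IsOpen Ω) {u v : E d → ℝ} (h : ∀ y ∈ Ω, u y = v y)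
    (ι : Fin m → Fin d) {x : E d} (hx : x ∈ Ω) : partialDeriv ι u x = partialDeriv ι v x := by
  have : u =ᶠ[𝓝 x] v := by
    filter_upwards [hΩ.mem_nhds hx] with y hy using h y hy
  unfold partialDeriv
  rw [(this.iteratedFDeriv ℝ m).eq_of_nhds]

theorem partialDeriv_sub (ι : Fin m → Fin d) {u v : E d → ℝ} {x : E d} (hu : ContDiffAt ℝ m u x)
    (hv : ContDiffAt ℝ m v x) :
    partialDeriv ι (fun y => u y - v y) x = partialDeriv ι u x - partialDeriv ι v x := by
  unfold partialDeriv
  change iteratedFDeriv ℝ m (u - v) x _ = _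
  rw [iteratedFDeriv_sub_apply hu hv]
  rfl

theorem partialDeriv_sub_const (hm : 0 < m) (ι : Fin m → Fin d) {u : E d → ℝ} {x : E d}
    (hu : ContDiffAt ℝ m u x) (c : ℝ) :
    partialDeriv ι (fun y => u y - c) x = partialDeriv ι u x := by
  rw [partialDeriv_sub ι hu contDiffAt_const]
  unfold partialDeriv
  rw [iteratedFDeriv_const_of_ne hm.ne']
  simp

theorem contDiffOn_of_isFeasible {r : ℝ} (hΩ : IsUnionOfBalls Ω r) (hr : 0 < r) (hm : 0 < m)
    {M D : ℝ} (hH : RichRKHS H m M D) {f : E d → ℝ} {c : ℝ} {A : H →L[ℝ] H}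
    (hA : IsFeasible f c A) :
    ContDiffOn ℝ m f Ω ∧
      ∀ ι : Fin m → Fin d, BddAbove (Set.range fun z : Ω => |partialDeriv ι f z|) := by
  have hO := hΩ.isOpen
  have heq : ∀ y ∈ Ω, f y - c = inner ℝ (featureExt H y) (A (featureExt H y)) := fun y hy => by
    have := hA.2 ⟨y, hy⟩
    rwa [← featureExt_coe] at this
  have hq := contDiffOn_quadratic hO hH.kernel_class A
  have hf : ContDiffOn ℝ m f Ω :=
    (hq.add (contDiffOn_const (c := c))).congr fun y hy => by rw [← heq y hy]; ring
  refine ⟨hf, fun ι => ?_⟩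
  obtain ⟨C, hC⟩ := exists_abs_partialDeriv_quadratic_le hΩ hr hH A
  refine ⟨C, ?_⟩
  rintro _ ⟨z, rfl⟩
  have h1 := partialDeriv_sub_const hm ι ((hf z z.2).contDiffAt (hO.mem_nhds z.2)) c
  have h2 := partialDeriv_congr hO heq ι z.2
  simp only
  rw [← h1, h2]
  exact hC ι z z.2

theorem abs_partialDeriv_le_seminormOn {f : E d → ℝ}
    (hb : ∀ ι : Fin m → Fin d, BddAbove (Set.range fun z : Ω => |partialDeriv ι f z|))
    (ι : Fin m → Fin d) {x : E d} (hx : x ∈ Ω) : |partialDeriv ι f x| ≤ seminormOn Ω m f :=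
  (le_ciSup (hb ι) ⟨x, hx⟩).trans
    (le_ciSup (f := fun ι : Fin m → Fin d => ⨆ x : Ω, |partialDeriv ι f x|)
      (Set.finite_range _).bddAbove ι)

theorem seminormOn_nonneg (Ω : Set (E d)) (m : ℕ) (f : E d → ℝ) : 0 ≤ seminormOn Ω m f :=
  Real.iSup_nonneg fun _ => Real.iSup_nonneg fun _ => abs_nonneg _

end DerivativeBounds

/-! ### Trace of a compression -/

section Trace

variable {H : Type*} [NormedAddCommGroup H] [InnerProductSpace ℝ H]

theorem inner_sum_smul_sum_smul {n : ℕ} (a b : Fin n → ℝ) (v w : Fin n → H) :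
    inner ℝ (∑ j, a j • v j) (∑ k, b k • w k) = ∑ j, ∑ k, a j * b k * inner ℝ (v j) (w k) := by
  rw [sum_inner]
  refine Finset.sum_congr rfl fun j _ => ?_
  rw [inner_sum]
  refine Finset.sum_congr rfl fun k _ => ?_
  rw [inner_smul_left, inner_smul_right, conj_trivial]
  ring

variable [CompleteSpace H]

theorem exists_hilbertBasis_hasSum (A : H →L[ℝ] H) (hA : A.IsPositive) (hfin : posTrace A ≠ ⊤) :
    ∃ (w : Set H) (b : HilbertBasis w ℝ H),
      HasSum (fun e : w => inner ℝ (b e) (A (b e))) (posTrace A).toReal := by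
  obtain ⟨b, hb⟩ := (exists_hilbertBasis ℝ H).choose_spec
  refine ⟨_, b, ?_⟩
  have h := ENNReal.hasSum_toReal hfin
  have h2 : (posTrace A).toReal = ∑' e : (exists_hilbertBasis ℝ H).choose,
      (ENNReal.ofReal (inner ℝ (e : H) (A e))).toReal := by
    rw [posTrace, ENNReal.tsum_toReal_eq]
    exact fun _ => ENNReal.ofReal_ne_top
  rw [h2]
  convert h using 2 with e
  rw [hb, ENNReal.toReal_ofReal (hA.inner_nonneg_right _)]

/-- The trace of the compression of `A` to the span of an orthonormal family is at most the trace
of `A`. -/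
theorem sum_inner_le_posTrace {n : ℕ} {v : Fin n → H} (hv : Orthonormal ℝ v) {A : H →L[ℝ] H}
    (hA : A.IsPositive) (hfin : posTrace A ≠ ⊤) :
    ∑ j, inner ℝ (v j) (A (v j)) ≤ (posTrace A).toReal := by
  obtain ⟨w, b, hb⟩ := exists_hilbertBasis_hasSum A hA hfin
  have h1 : HasSum (fun e => ∑ j, inner ℝ (v j) (b e) * inner ℝ (b e) (A (v j)))
      (∑ j, inner ℝ (v j) (A (v j))) :=
    hasSum_sum fun j _ => b.hasSum_inner_mul_inner (v j) (A (v j))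
  have h2 : HasSum (fun e => ∑ j, ∑ k, inner ℝ (v j) (b e) * inner ℝ (b e) (v k) *
      inner ℝ (v j) (A (v k))) (∑ j, inner ℝ (v j) (A (v j))) := by
    have h3 : HasSum (fun e => ∑ j, ∑ k, inner ℝ (v j) (b e) * inner ℝ (b e) (v k) *
        inner ℝ (v j) (A (v k))) (∑ j, ∑ k, inner ℝ (v j) (v k) * inner ℝ (v j) (A (v k))) :=
      hasSum_sum fun j _ => hasSum_sum fun k _ =>
        (b.hasSum_inner_mul_inner (v j) (v k)).mul_right _
    convert h3 using 1
    refine Finset.sum_congr rfl fun j _ => ?_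
    rw [Finset.sum_eq_single j]
    · rw [real_inner_self_eq_norm_sq, hv.1 j]; ring
    · intro k _ hk; rw [hv.2 hk.symm, zero_mul]
    · simp
  have h4 := (h1.mul_left 2).sub h2
  have h5 : 2 * ∑ j, inner ℝ (v j) (A (v j)) - ∑ j, inner ℝ (v j) (A (v j)) ≤
      (posTrace A).toReal := by
    -- With `P` the orthogonal projection of the basis vector, the termwise inequality is `0 ≤ ⟨b e
    -- - P, A (b e - P)⟩`. Summed over the basis, the cross terms give twice the trace of the
    -- compression and the last term gives it once, so no independence of the basis is needed.
    refine hasSum_le (fun e => ?_) h4 hb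
    set P : H := ∑ j, inner ℝ (v j) (b e) • v j with hP
    have hpos := hA.inner_nonneg_right (b e - P)
    rw [map_sub, inner_sub_left, inner_sub_right, inner_sub_right] at hpos
    have e1 : inner ℝ (b e) (A P) = ∑ j, inner ℝ (v j) (b e) * inner ℝ (b e) (A (v j)) := by
      simp only [hP, map_sum, map_smul, inner_sum, inner_smul_right]
    have e2 : inner ℝ P (A (b e)) = inner ℝ (b e) (A P) := by
      rw [← hA.inner_left_eq_inner_right, real_inner_comm]
    have e3 : inner ℝ P (A P) = ∑ j, ∑ k, inner ℝ (v j) (b e) * inner ℝ (b e) (v k) *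
        inner ℝ (v j) (A (v k)) := by
      simp only [hP, map_sum, map_smul, inner_sum_smul_sum_smul, real_inner_comm (v _) (b e)]
    rw [e2, e1, e3] at hpos
    linarith
  linarith

end Trace

/-! ### Solvability of the finite-dimensional problem -/

section FiniteDimensional

variable {n : ℕ}

theorem exists_eq_transpose_mul_self {B : Matrix (Fin n) (Fin n) ℝ} (hB : B.PosSemidef) :
    ∃ C : Matrix (Fin n) (Fin n) ℝ, B = C.transpose * C := by
  open scoped MatrixOrder Matrix.Norms.L2Operator in
  obtain ⟨C, rfl⟩ := CStarAlgebra.nonneg_iff_eq_star_mul_self.mp hB.nonneg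
  exact ⟨C, rfl⟩

theorem quadForm_eq_sum (R B : Matrix (Fin n) (Fin n) ℝ) (i : Fin n) :
    quadForm R B i = ∑ j, ∑ k, R j i * R k i * B j k := by
  simp only [quadForm, dotProduct, Matrix.mulVec, Finset.mul_sum]
  exact Finset.sum_congr rfl fun j _ => Finset.sum_congr rfl fun k _ => by ring

theorem quadForm_transpose_mul_self (R C : Matrix (Fin n) (Fin n) ℝ) (i : Fin n) :
    quadForm R (C.transpose * C) i = ∑ l, (∑ j, C l j * R j i) ^ 2 := by
  rw [quadForm, Matrix.dotProduct_mulVec, ← Matrix.vecMul_vecMul, ← Matrix.dotProduct_mulVec,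
    Matrix.vecMul_transpose]
  simp only [dotProduct, Matrix.mulVec, sq]

theorem trace_transpose_mul_self (C : Matrix (Fin n) (Fin n) ℝ) :
    (C.transpose * C).trace = ∑ l, ∑ j, C l j ^ 2 := by
  rw [Matrix.trace, Finset.sum_comm]
  simp only [Matrix.diag_apply, Matrix.mul_apply, Matrix.transpose_apply, sq]

theorem posSemidef_transpose_mul_self (C : Matrix (Fin n) (Fin n) ℝ) :
    (C.transpose * C).PosSemidef := by
  simpa using Matrix.posSemidef_conjTranspose_mul_self C

/-- Compactness in the variables `(c, C)` with `B = CᵀC`, where semidefiniteness is automatic and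
the constraints are polynomial equations. Feasible points at least as good as a given one of value
`v0` have `v0 ≤ c ≤ y i0`, and then `∑ C_{lj}² ≤ (y i0 - v0) / lam`. -/
theorem isGreatest_objectiveValues (hn : 0 < n) (R : Matrix (Fin n) (Fin n) ℝ) (y : Fin n → ℝ)
    {lam : ℝ} (hlam : 0 < lam) (hne : (objectiveValues R y lam).Nonempty) :
    IsGreatest (objectiveValues R y lam) (optimalValue R y lam) := by
  suffices h : ∃ p, IsGreatest (objectiveValues R y lam) p by
    obtain ⟨p, hp⟩ := h
    rwa [optimalValue, hp.csSup_eq]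
  obtain ⟨v0, c0, B0, hB0, hf0, hv0⟩ := hne
  obtain ⟨C0, rfl⟩ := exists_eq_transpose_mul_self hB0
  let i0 : Fin n := ⟨0, hn⟩
  have hcy : ∀ (c : ℝ) (C : Matrix (Fin n) (Fin n) ℝ),
      (∀ i, y i - c = quadForm R (C.transpose * C) i) → c ≤ y i0 := by
    intro c C h
    have := h i0
    rw [quadForm_transpose_mul_self] at this
    have h2 : 0 ≤ ∑ l, (∑ j, C l j * R j i0) ^ 2 := Finset.sum_nonneg fun _ _ => sq_nonneg _
    linarith
  set t := (y i0 - v0) / lam with ht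
  set K : Set (ℝ × (Fin n → Fin n → ℝ)) :=
    (Set.Icc v0 (y i0) ×ˢ Set.Icc (fun _ _ => -√t) (fun _ _ => √t)) ∩
      {p | ∀ i, y i - p.1 = ∑ l, (∑ j, p.2 l j * R j i) ^ 2} with hK
  set obj : ℝ × (Fin n → Fin n → ℝ) → ℝ := fun p => p.1 - lam * ∑ l, ∑ j, p.2 l j ^ 2 with hobj
  have hKc : IsCompact K := by
    refine (isCompact_Icc.prod isCompact_Icc).inter_right ?_
    rw [Set.ofPred_forall]
    refine isClosed_iInter fun i => isClosed_eq (by fun_prop) (by fun_prop)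
  have hmemK : ∀ (c : ℝ) (C : Matrix (Fin n) (Fin n) ℝ),
      (∀ i, y i - c = quadForm R (C.transpose * C) i) → v0 ≤ c - lam * ∑ l, ∑ j, C l j ^ 2 →
      (c, (C : Fin n → Fin n → ℝ)) ∈ K := by
    intro c C h hv
    have hc := hcy c C h
    have hS : 0 ≤ ∑ l, ∑ j, C l j ^ 2 :=
      Finset.sum_nonneg fun _ _ => Finset.sum_nonneg fun _ _ => sq_nonneg _
    have hlS : 0 ≤ lam * ∑ l, ∑ j, C l j ^ 2 := by positivity
    have hSt : ∑ l, ∑ j, C l j ^ 2 ≤ t := by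
      rw [ht, le_div_iff₀ hlam]; linarith
    have hent : ∀ l j, |C l j| ≤ √t := by
      intro l j
      refine Real.abs_le_sqrt (le_trans ?_ hSt)
      refine le_trans ?_ (Finset.single_le_sum (f := fun l => ∑ j, C l j ^ 2)
        (fun _ _ => Finset.sum_nonneg fun _ _ => sq_nonneg _) (Finset.mem_univ l))
      exact Finset.single_le_sum (f := fun j => C l j ^ 2) (fun _ _ => sq_nonneg _)
        (Finset.mem_univ j)
    refine ⟨⟨⟨by linarith, hc⟩, ⟨fun l j => (abs_le.1 (hent l j)).1,
      fun l j => (abs_le.1 (hent l j)).2⟩⟩, fun i => ?_⟩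
    rw [← quadForm_transpose_mul_self]; exact h i
  rw [trace_transpose_mul_self] at hv0
  obtain ⟨p, hpK, hmax⟩ := hKc.exists_isMaxOn ⟨_, hmemK c0 C0 hf0 hv0.le⟩
    (by fun_prop : Continuous obj).continuousOn
  refine ⟨obj p, ⟨p.1, (Matrix.of p.2).transpose * Matrix.of p.2,
    posSemidef_transpose_mul_self _, fun i => ?_, ?_⟩, ?_⟩
  · rw [quadForm_transpose_mul_self]; exact hpK.2 i
  · rw [trace_transpose_mul_self]; rfl
  · rintro _ ⟨c, B, hB, hf, rfl⟩
    obtain ⟨C, rfl⟩ := exists_eq_transpose_mul_self hB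
    rw [trace_transpose_mul_self]
    by_cases hv : v0 ≤ c - lam * ∑ l, ∑ j, C l j ^ 2
    · exact hmax (hmemK c C hf hv)
    · have h0 : obj (c0, C0) ≤ obj p := hmax (hmemK c0 C0 hf0 hv0.le)
      have h1 : obj (c0, C0) = v0 := hv0.symm
      push Not at hv
      linarith

end FiniteDimensional

/-! ### Passing between operators on `H` and matrices -/

section Discretization

variable {d : ℕ} {Ω : Set (E d)} {H : Type*} [NormedAddCommGroup H] [InnerProductSpace ℝ H]
  [CompleteSpace H] [RKHS ℝ H Ω ℝ] {m n : ℕ} {M D : ℝ}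

theorem rkhs_sum_apply {ι : Type*} (s : Finset ι) (u : ι → H) (x : Ω) :
    (∑ i ∈ s, u i) x = ∑ i ∈ s, u i x := by
  rw [← inner_feature, sum_inner]
  exact Finset.sum_congr rfl fun i _ => inner_feature _ _

theorem rkhs_smul_apply (c : ℝ) (u : H) (x : Ω) : (c • u) x = c * u x := by
  rw [← inner_feature, inner_smul_left, inner_feature]; rfl

/-- Pair the relation with a smooth function that vanishes at every sample but one. -/
theorem eq_zero_of_sum_smul_feature_eq_zero (hH : RichRKHS H m M D) {x : Fin n → Ω}
    (hx : Function.Injective x) {c : Fin n → ℝ} (hc : ∑ i, c i • feature H (x i) = 0) : c = 0 := by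
  funext j
  obtain ⟨w, hw⟩ := hH.smooth_mem (fun y => ∏ i ∈ Finset.univ.erase j, ‖y - x i‖ ^ 2)
    (contDiff_prod fun i _ => (contDiff_id.sub contDiff_const).norm_sq ℝ)
  have h1 : inner ℝ w (∑ i, c i • feature H (x i)) = 0 := by rw [hc, inner_zero_right]
  rw [inner_sum, Finset.sum_eq_single j] at h1
  · rw [inner_smul_right, inner_feature, hw] at h1
    refine (mul_eq_zero.1 h1).resolve_right (Finset.prod_ne_zero_iff.2 fun i hi => ?_)
    have : (x j : E d) ≠ x i := fun h =>
      (Finset.mem_erase.1 hi).1 (hx (Subtype.ext h)).symm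
    exact pow_ne_zero _ (norm_ne_zero_iff.2 (sub_ne_zero.2 this))
  · intro i _ hi
    rw [inner_smul_right, inner_feature, hw,
      Finset.prod_eq_zero (Finset.mem_erase.2 ⟨hi, Finset.mem_univ i⟩) (by simp), mul_zero]
  · simp

/-- The columns of a Cholesky factor are the coordinates of the feature vectors with respect to an
orthonormal family. -/
theorem exists_orthonormal_feature_eq (hH : RichRKHS H m M D) {x : Fin n → Ω}
    (hx : Function.Injective x) {R : Matrix (Fin n) (Fin n) ℝ}
    (hR : IsCholesky (kernelMatrix H x) R) :
    ∃ v : Fin n → H, Orthonormal ℝ v ∧ ∀ i, feature H (x i) = ∑ j, R j i • v j := by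
  have hK : ∀ i j, inner ℝ (feature H (x i)) (feature H (x j)) = ∑ l, R l i * R l j := by
    intro i j
    have := congrFun (congrFun hR.eq i) j
    rw [inner_feature_feature]
    simpa [kernelMatrix, Matrix.mul_apply] using this
  have hsum : ∀ a b : Fin n → ℝ, ∑ i, ∑ j, a i * b j * ∑ l, R l i * R l j =
      ∑ l, (∑ i, R l i * a i) * ∑ j, R l j * b j := by
    intro a b
    simp only [Finset.sum_mul_sum]
    simp only [Finset.mul_sum]
    conv_lhs => enter [2, i]; rw [Finset.sum_comm]
    rw [Finset.sum_comm]
    exact Finset.sum_congr rfl fun l _ => Finset.sum_congr rfl fun i _ =>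
      Finset.sum_congr rfl fun j _ => by ring
  have hdet : R.det ≠ 0 := by
    intro h0
    obtain ⟨c, hc, hRc⟩ := Matrix.exists_mulVec_eq_zero_iff.2 h0
    refine hc (eq_zero_of_sum_smul_feature_eq_zero hH hx ?_)
    have h1 : ∀ l, ∑ i, R l i * c i = 0 := fun l => congrFun hRc l
    rw [← inner_self_eq_zero (𝕜 := ℝ), inner_sum_smul_sum_smul]
    simp only [hK]
    rw [hsum]
    simp [h1]
  have hunit : IsUnit R.det := hdet.isUnit
  have hinv : ∀ i j, ∑ l, R⁻¹ i l * R l j = if i = j then 1 else 0 := by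
    intro i j
    rw [← Matrix.mul_apply, Matrix.nonsing_inv_mul _ hunit, Matrix.one_apply]
  have hinv' : ∀ i j, ∑ l, R i l * R⁻¹ l j = if i = j then 1 else 0 := by
    intro i j
    rw [← Matrix.mul_apply, Matrix.mul_nonsing_inv _ hunit, Matrix.one_apply]
  -- The Gram matrix of these vectors is `R⁻ᵀ (RᵀR) R⁻¹ = 1`.
  refine ⟨fun j => ∑ i, R⁻¹ i j • feature H (x i), ?_, fun i => ?_⟩
  · rw [orthonormal_iff_ite]
    intro j k
    rw [inner_sum_smul_sum_smul]
    simp only [hK]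
    rw [hsum]
    simp [hinv', eq_comm]
  · simp only [Finset.smul_sum, smul_smul]
    rw [Finset.sum_comm]
    simp only [← Finset.sum_smul]
    have : ∀ l, ∑ j, R j i * R⁻¹ l j = if l = i then 1 else 0 := by
      intro l; rw [← hinv l i]; exact Finset.sum_congr rfl fun _ _ => mul_comm _ _
    simp [this]

/-- Every feasible pair of the infinite-dimensional problem gives one of the finite-dimensional
problem, of no larger trace. -/
theorem exists_compression {x : Fin n → Ω} {R : Matrix (Fin n) (Fin n) ℝ} {v : Fin n → H}
    (hv : Orthonormal ℝ v) (hvx : ∀ i, feature H (x i) = ∑ j, R j i • v j) {f : E d → ℝ} {c : ℝ}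
    {A : H →L[ℝ] H} (hA : IsFeasible f c A) (hfin : posTrace A ≠ ⊤) :
    ∃ B : Matrix (Fin n) (Fin n) ℝ, B.PosSemidef ∧ (∀ i, f (x i) - c = quadForm R B i) ∧
      B.trace ≤ (posTrace A).toReal := by
  have key : ∀ a : Fin n → ℝ, inner ℝ (∑ j, a j • v j) (A (∑ j, a j • v j)) =
      ∑ j, ∑ k, a j * a k * inner ℝ (v j) (A (v k)) := by
    intro a
    rw [map_sum]
    simp only [map_smul]
    exact inner_sum_smul_sum_smul a a v fun k => A (v k)
  refine ⟨Matrix.of fun j k => inner ℝ (v j) (A (v k)), ?_, fun i => ?_, ?_⟩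
  · refine Matrix.PosSemidef.of_dotProduct_mulVec_nonneg ?_ fun a => ?_
    · ext j k
      simp only [Matrix.conjTranspose_apply, Matrix.of_apply, star_trivial]
      rw [← hA.1.inner_left_eq_inner_right, real_inner_comm]
    · have := hA.1.inner_nonneg_right (∑ j, a j • v j)
      rw [key] at this
      refine this.trans (le_of_eq ?_)
      simp only [dotProduct, Matrix.mulVec, Finset.mul_sum, Matrix.of_apply, Pi.star_apply,
        star_trivial]
      exact Finset.sum_congr rfl fun j _ => Finset.sum_congr rfl fun k _ => by ring
  · rw [hA.2, hvx, key, quadForm_eq_sum]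
    rfl
  · exact sum_inner_le_posTrace hv hA.1 hfin

/-- For `B = CᵀC` take the sum of the squares of `u l = ∑_j C_{lj} v_j`. The product bound costs `M
‖u l‖²`, and orthonormality makes `∑ ‖u l‖²` the trace. -/
theorem exists_function_of_posSemidef (hH : RichRKHS H m M D) {x : Fin n → Ω}
    {R : Matrix (Fin n) (Fin n) ℝ} {v : Fin n → H} (hv : Orthonormal ℝ v)
    (hvx : ∀ i, feature H (x i) = ∑ j, R j i • v j) {B : Matrix (Fin n) (Fin n) ℝ}
    (hB : B.PosSemidef) :
    ∃ W : H, (∀ i, W (x i) = quadForm R B i) ∧ (∀ y : Ω, 0 ≤ W y) ∧ ‖W‖ ≤ M * B.trace := by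
  obtain ⟨C, rfl⟩ := exists_eq_transpose_mul_self hB
  set u : Fin n → H := fun l => ∑ j, C l j • v j with hu
  choose w hw hwn using fun l => hH.mul_mem (u l) (u l)
  have hvR : ∀ i j, v j (x i) = R j i := by
    intro i j
    rw [← inner_feature, hvx, hv.inner_right_fintype]
  refine ⟨∑ l, w l, fun i => ?_, fun y => ?_, ?_⟩
  · rw [rkhs_sum_apply, quadForm_transpose_mul_self]
    refine Finset.sum_congr rfl fun l _ => ?_
    rw [hw, ← sq, hu]
    simp only [rkhs_sum_apply, rkhs_smul_apply, hvR]
  · rw [rkhs_sum_apply]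
    exact Finset.sum_nonneg fun l _ => by rw [hw]; exact mul_self_nonneg _
  · rw [trace_transpose_mul_self, Finset.mul_sum]
    refine (norm_sum_le _ _).trans (Finset.sum_le_sum fun l _ => (hwn l).trans (le_of_eq ?_))
    have : ‖u l‖ ^ 2 = ∑ j, C l j ^ 2 := by
      rw [← real_inner_self_eq_norm_sq, hu]
      simp only [hv.inner_sum, conj_trivial, sq]
    rw [← this]; ring

end Discretization

/-! ### Error of approximate solutions -/

section ErrorBounds

variable {d : ℕ} {Ω : Set (E d)} {H : Type*} [NormedAddCommGroup H] [InnerProductSpace ℝ H]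
  [CompleteSpace H] [RKHS ℝ H Ω ℝ] {m n : ℕ} {M D r : ℝ}

theorem approximate_solution_bounds (hd : 0 < d) (hr : 0 < r) (hΩ : IsUnionOfBalls Ω r)
    (hm : 0 < m) (hH : RichRKHS H m M D) (hn : 0 < n) (x : Fin n → Ω)
    {R : Matrix (Fin n) (Fin n) ℝ} {v : Fin n → H} (hv : Orthonormal ℝ v)
    (hvx : ∀ i, feature H (x i) = ∑ j, R j i • v j) (f : E d → ℝ) {lam : ℝ} (hlam : 0 < lam)
    (hfill : fillDistance x ≤ r / max 1 (18 * ((m : ℝ) - 1) ^ 2))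
    {η : ℝ} (hη : η = C₀ d m * fillDistance x ^ m) (hlamη : 2 * M * D * η ≤ lam)
    {A : H →L[ℝ] H} (hA : IsFeasible f (infOn Ω f) A) (hfin : posTrace A ≠ ⊤)
    (hopt : IsGreatest (objectiveValues R (fun i => f (x i)) lam)
      (optimalValue R (fun i => f (x i)) lam))
    {θ₁ θ₂ τ₁ τ₂ : ℝ} (hθ₁ : 0 ≤ θ₁) (hτ₁ : 0 ≤ τ₁)
    (hθ₂ : θ₂ ≤ lam / 8) (hτ₂ : τ₂ ≤ lam / 8) {c : ℝ} {B : Matrix (Fin n) (Fin n) ℝ}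
    (hB : IsApproxSolution R (fun i => f (x i)) lam θ₁ θ₂ τ₁ τ₂ c B) :
    |c - infOn Ω f| ≤ 7 * (2 * τ₁ + η * seminormOn Ω m f)
        + 6 * (θ₁ + lam * (posTrace A).toReal) ∧
      B.trace ≤ 8 * (posTrace A).toReal + 8 * (η / lam) * seminormOn Ω m f
        + 8 * ((θ₁ + 2 * τ₁) / lam) := by
  have hO := hΩ.isOpen
  have : Nonempty Ω := ⟨x ⟨0, hn⟩⟩
  obtain ⟨hf, hbdd⟩ := contDiffOn_of_isFeasible hΩ hr hm hH hA
  obtain ⟨W, hWx, hW0, hWn⟩ := exists_function_of_posSemidef hH hv hvx hB.posSemidef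
  have hη0 : 0 ≤ η := by
    rw [hη]; exact mul_nonneg (C₀_nonneg d m) (pow_nonneg (fillDistance_nonneg x) m)
  have hF0 := seminormOn_nonneg Ω m f
  set F := seminormOn Ω m f
  set t := (posTrace A).toReal with ht
  have ht0 : 0 ≤ t := ENNReal.toReal_nonneg
  have hT0 : 0 ≤ B.trace := hB.posSemidef.trace_nonneg
  set T := B.trace
  have hD0 : 0 ≤ D := zero_le_one.trans hH.one_le_D
  have hcW := contDiffOn_inner_featureExt hO hH.kernel_class W
  have hsamp : ∀ z ∈ Ω, |f z - c - inner ℝ W (featureExt H z)| ≤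
      2 * (τ₁ + τ₂ * T) + η * (F + D * (M * T)) := by
    intro z hz
    rw [hη]
    refine abs_le_of_abs_sample_le hd hΩ hm hn x hfill
      (g := fun z => f z - c - inner ℝ W (featureExt H z))
      ((hf.sub contDiffOn_const).sub hcW) (fun y hy ι => ?_) (fun i => ?_) hz
    · have hfy := (hf y hy).contDiffAt (hO.mem_nhds hy)
      rw [partialDeriv_sub ι (hfy.sub contDiffAt_const) ((hcW y hy).contDiffAt (hO.mem_nhds hy)),
        partialDeriv_sub_const hm ι hfy]
      refine (abs_sub _ _).trans (add_le_add (abs_partialDeriv_le_seminormOn hbdd ι hy) ?_)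
      refine (abs_partialDeriv_inner_featureExt_le hO hH ι W hy).trans ?_
      gcongr
    · rw [featureExt_coe, inner_feature, hWx]
      exact hB.constraints i
  have hlow : ∀ z : Ω, c - (2 * (τ₁ + τ₂ * T) + η * (F + D * (M * T))) ≤ f z := by
    intro z
    have h1 := (abs_le.1 (hsamp z z.2)).1
    have h2 := hW0 z
    rw [featureExt_coe, inner_feature] at h1
    linarith
  have hI : c - (2 * (τ₁ + τ₂ * T) + η * (F + D * (M * T))) ≤ infOn Ω f := le_ciInf hlow
  obtain ⟨B', hB', hfB', htr⟩ := exists_compression hv hvx hA hfin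
  have hII : infOn Ω f - lam * B'.trace ≤ optimalValue R (fun i => f (x i)) lam :=
    hopt.2 ⟨_, B', hB', hfB', rfl⟩
  have hIII := hB.objective
  have htr' : lam * B'.trace ≤ lam * t := by gcongr
  have h1 : 2 * M * D * η * T ≤ lam * T := by gcongr
  have h2 : τ₂ * T ≤ lam / 8 * T := by gcongr
  have h3 : θ₂ * T ≤ lam / 8 * T := by gcongr
  have hηF : 0 ≤ η * F := mul_nonneg hη0 hF0
  -- The coefficient is `1/4 + 1/2`: `2 τ₂ T ≤ λT / 4`, and `η D M T ≤ λT / 2` by the assumption on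
  -- `lam`.
  have hup : c - infOn Ω f ≤ 2 * τ₁ + η * F + 3 / 4 * (lam * T) := by
    have h4 : η * (F + D * (M * T)) = η * F + (2 * M * D * η * T) / 2 := by ring
    rw [h4] at hI
    linarith
  have hdn : -(lam * t) - θ₁ + 7 / 8 * (lam * T) ≤ c - infOn Ω f := by
    change _ + lam * T ≤ _ at hIII
    linarith
  -- The gap `7/8 - 3/4 = 1/8` between the two bounds gives the `8`. Inserted into `hup`, it yields
  -- `1 + 6 = 7` and `6`.
  have hT : lam * T ≤ 8 * (2 * τ₁ + η * F + θ₁ + lam * t) := by linarith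
  have hlt : 0 ≤ lam * t := by positivity
  have hlT : 0 ≤ lam * T := by positivity
  refine ⟨abs_le.2 ⟨by linarith, by linarith⟩, ?_⟩
  have h5 : T ≤ 8 * (2 * τ₁ + η * F + θ₁ + lam * t) / lam := by
    rw [le_div_iff₀ hlam]; linarith
  refine h5.trans (le_of_eq ?_)
  field_simp
  ring

end ErrorBounds

/-! ### Cholesky factorization with entries in `H` -/

/-- Closure under composition requires functions smooth on all of `ℝ`, so `t` is replaced by a
positive smooth function that agrees with it for `t ≥ δ`. -/
theorem exists_smooth_inv_sqrt {δ : ℝ} (hδ : 0 < δ) :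
    ∃ s : ℝ → ℝ, ContDiff ℝ ∞ s ∧ ∀ t, δ ≤ t → s t ^ 2 * t = 1 := by
  set χ : ℝ → ℝ := fun t => Real.smoothTransition (2 * t / δ - 1) with hχ
  have hχs : ContDiff ℝ ∞ χ :=
    Real.smoothTransition.contDiff.comp (by fun_prop)
  set θ : ℝ → ℝ := fun t => χ t * t + (1 - χ t) * δ with hθ
  have hθs : ContDiff ℝ ∞ θ := by fun_prop
  have hpos : ∀ t, 0 < θ t := by
    intro t
    have h0 : 0 ≤ χ t := Real.smoothTransition.nonneg _
    have h1 : χ t ≤ 1 := Real.smoothTransition.le_one _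
    rcases le_or_gt t (δ / 2) with h | h
    · have : χ t = 0 := Real.smoothTransition.zero_of_nonpos (by
        rw [sub_nonpos, div_le_one hδ]; linarith)
      simp only [hθ, this]; linarith
    · simp only [hθ]
      nlinarith
  refine ⟨fun t => (√(θ t))⁻¹, (hθs.sqrt fun t => (hpos t).ne').inv fun t =>
    (Real.sqrt_pos.2 (hpos t)).ne', fun t ht => ?_⟩
  have h1 : χ t = 1 := Real.smoothTransition.one_of_one_le (by
    rw [le_sub_iff_add_le, le_div_iff₀ hδ]; linarith)
  have h2 : θ t = t := by simp only [hθ, h1]; ring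
  have ht0 : 0 < t := hδ.trans_le ht
  simp only [h2]
  rw [inv_pow, Real.sq_sqrt ht0.le, inv_mul_cancel₀ ht0.ne']

/-- One elimination step: `σ` is an inverse square root of the pivot, and the remaining form is the
Schur complement. -/
theorem sum_mul_mul_eq_sq_add {k : ℕ} (G : Fin (k + 1) → Fin (k + 1) → ℝ) (hG : ∀ i j, G i j = G j i)
    {σ : ℝ} (hσ : σ ^ 2 * G 0 0 = 1) (v : Fin (k + 1) → ℝ) :
    ∑ i, ∑ j, G i j * v i * v j = (∑ j, σ * G 0 j * v j) ^ 2 +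
      ∑ i : Fin k, ∑ j : Fin k,
        (G i.succ j.succ - (σ * G 0 i.succ) * (σ * G 0 j.succ)) * v i.succ * v j.succ := by
  have h1 : ∑ j, σ * G 0 j * v j = σ * G 0 0 * v 0 + ∑ j : Fin k, σ * G 0 j.succ * v j.succ :=
    Fin.sum_univ_succ _
  set T : ℝ := ∑ j : Fin k, σ * G 0 j.succ * v j.succ with hT
  have h2 : ∑ i : Fin k, ∑ j : Fin k,
        (G i.succ j.succ - (σ * G 0 i.succ) * (σ * G 0 j.succ)) * v i.succ * v j.succ =
      ∑ i : Fin k, ∑ j : Fin k, G i.succ j.succ * v i.succ * v j.succ - T ^ 2 := by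
    rw [hT, sq, Finset.sum_mul_sum, ← Finset.sum_sub_distrib]
    refine Finset.sum_congr rfl fun i _ => ?_
    rw [← Finset.sum_sub_distrib]
    exact Finset.sum_congr rfl fun j _ => by ring
  have h3 : ∑ j : Fin k, G 0 j.succ * v 0 * v j.succ = σ * G 0 0 * v 0 * T := by
    rw [hT, Finset.mul_sum]
    refine Finset.sum_congr rfl fun j _ => ?_
    linear_combination (-(G 0 j.succ * v 0 * v j.succ)) * hσ
  have h4 : ∑ i : Fin k, G i.succ 0 * v i.succ * v 0 = σ * G 0 0 * v 0 * T := by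
    rw [← h3]
    exact Finset.sum_congr rfl fun j _ => by rw [hG]; ring
  rw [h2, h1, Fin.sum_univ_succ]
  simp_rw [Fin.sum_univ_succ (fun j => G _ j * v _ * v j), Finset.sum_add_distrib]
  rw [h3, h4]
  linear_combination (-(G 0 0 * v 0 ^ 2)) * hσ

section

variable {d : ℕ} {Ω : Set (E d)} {H : Type*} [NormedAddCommGroup H] [InnerProductSpace ℝ H]
  [CompleteSpace H] [RKHS ℝ H Ω ℝ] {m : ℕ} {M D : ℝ}

theorem continuous_apply (hΩ : IsOpen Ω) (hK : IsKernelOfClass H m) (u : H) :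
    Continuous fun x : Ω => u x := by
  have h := (contDiffOn_inner_featureExt hΩ hK u).continuousOn
  rw [continuousOn_iff_continuous_domRestrict] at h
  refine h.congr fun x => ?_
  simp [featureExt_coe, inner_feature]

theorem RichRKHS.exists_comp (hH : RichRKHS H m M D) {s : ℝ → ℝ} (hs : ContDiff ℝ ∞ s) (u : H) :
    ∃ w : H, ∀ x : Ω, w x = s (u x) := by
  obtain ⟨w, hw⟩ := hH.comp_mem 1 (fun y => s (y 0)) (hs.comp (by fun_prop)) (fun _ => u)
  exact ⟨w, hw⟩

theorem rkhs_add_apply (u v : H) (x : Ω) : (u + v) x = u x + v x := by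
  simp [← inner_feature, inner_add_left]

theorem rkhs_sub_apply (u v : H) (x : Ω) : (u - v) x = u x - v x := by
  simp [← inner_feature, inner_sub_left]

/-- The pivot is positive at `z`, hence bounded below nearby, and its inverse square root there is
the value of an element of `H`. The Schur complement has entries in `H` and is again positive
definite at `z`, so induction applies. -/
theorem RichRKHS.exists_ldl (hH : RichRKHS H m M D) (hΩ : IsOpen Ω) (z : Ω) (k : ℕ) :
    ∀ g : Fin k → Fin k → H, (∀ i j, g i j = g j i) →
      (∀ v : Fin k → ℝ, v ≠ 0 → 0 < ∑ i, ∑ j, g i j z * v i * v j) →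
      ∃ l : Fin k → Fin k → H, ∀ᶠ x in 𝓝 z, ∀ v : Fin k → ℝ,
        ∑ i, ∑ j, g i j x * v i * v j = ∑ i, (∑ j, l i j x * v j) ^ 2 := by
  induction k with
  | zero => exact fun g _ _ => ⟨g, by simp⟩
  | succ k ih =>
    intro g hg hpos
    have h00 : 0 < g 0 0 z := by
      have := hpos (Pi.single 0 1) (by simp)
      simpa [Pi.single_apply] using this
    obtain ⟨s, hs, hs2⟩ := exists_smooth_inv_sqrt (half_pos h00)
    obtain ⟨w, hw⟩ := hH.exists_comp hs (g 0 0)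
    choose a ha _ using fun j => hH.mul_mem w (g 0 j)
    choose b hb _ using fun i j => hH.mul_mem (a i) (a j)
    have hev : ∀ᶠ x in 𝓝 z, w x ^ 2 * g 0 0 x = 1 := by
      have h := (continuous_apply hΩ hH.kernel_class (g 0 0)).continuousAt.eventually
        (lt_mem_nhds (half_lt_self h00))
      filter_upwards [h] with x hx
      rw [hw]; exact hs2 _ hx.le
    have hstep : ∀ x : Ω, w x ^ 2 * g 0 0 x = 1 → ∀ v : Fin (k + 1) → ℝ,
        ∑ i, ∑ j, g i j x * v i * v j = (∑ j, a j x * v j) ^ 2 + ∑ i : Fin k, ∑ j : Fin k,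
          (g i.succ j.succ - b i.succ j.succ) x * v i.succ * v j.succ := by
      intro x hx v
      rw [sum_mul_mul_eq_sq_add (fun i j => g i j x) (fun i j => by rw [hg]) hx v]
      simp only [rkhs_sub_apply, hb, ha]
    obtain ⟨l, hl⟩ := ih (fun i j => g i.succ j.succ - b i.succ j.succ)
      (fun i j => by
        have : b i.succ j.succ = b j.succ i.succ := by
          apply DFunLike.coe_injective (F := H)
          funext x
          rw [hb, hb, mul_comm]
        rw [hg, this])
      (fun v hv => by
        have h1 := hev.self_of_nhds
        have hv' : ∀ t : ℝ, (Fin.cons t v : Fin (k + 1) → ℝ) ≠ 0 := by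
          intro t h
          apply hv
          funext i
          simpa using congrFun h i.succ
        have ha0 : a 0 z ≠ 0 := by
          intro h
          rw [ha] at h
          rw [sq, mul_assoc, h, mul_zero] at h1
          exact zero_ne_one h1
        -- The first coordinate is chosen to annihilate the square that was split off.
        have h2 := hpos _ (hv' (-(∑ j : Fin k, a j.succ z * v j) / a 0 z))
        rw [hstep z h1, Fin.sum_univ_succ] at h2
        simp only [Fin.cons_zero, Fin.cons_succ] at h2
        rw [mul_div_cancel₀ _ ha0] at h2
        simpa using h2)
    refine ⟨Fin.cons a fun i => Fin.cons 0 (l i), ?_⟩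
    filter_upwards [hev, hl] with x hx hlx v
    have h0 : (0 : H) x = 0 := by rw [← inner_feature, inner_zero_left]
    rw [hstep x hx, hlx (fun i => v i.succ)]
    refine Eq.symm ((Fin.sum_univ_succ _).trans ?_)
    simp only [Fin.cons_zero, Fin.cons_succ]
    congr 1
    refine Finset.sum_congr rfl fun i _ => ?_
    rw [Fin.sum_univ_succ]
    simp [h0]

end

/-! ### Local sums of squares at the minimizers -/

theorem iteratedFDeriv_two_self_eq_sum {d : ℕ} (f : E d → ℝ) (x y : E d) :
    iteratedFDeriv ℝ 2 f x (fun _ => y) = ∑ i, ∑ j, y i * y j * partialDeriv ![i, j] f x := by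
  simp only [partialDeriv, iteratedFDeriv_two_apply, Matrix.cons_val_zero, Matrix.cons_val_one]
  conv_lhs => rw [eq_sum_single y]
  simp only [map_sum, map_smul, sum_apply, smul_apply,
    smul_eq_mul, Finset.mul_sum]
  rw [Finset.sum_comm]
  exact Finset.sum_congr rfl fun i _ => Finset.sum_congr rfl fun j _ => by ring

theorem IsGlobalMin.sub_eq_integral {d : ℕ} {f : E d → ℝ} (hf : ContDiff ℝ 2 f) {z : E d}
    (hz : IsGlobalMin f z) (y : E d) :
    f (z + y) - f z =
      ∫ t in (0 : ℝ)..1, (1 - t) * iteratedFDeriv ℝ 2 f (z + t • y) (fun _ => y) := by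
  have h := map_add_eq_sum_add_integral_iteratedFDeriv (f := f) (n := 1) (x := z) (y := y)
    fun t _ => (by exact_mod_cast hf.contDiffAt)
  have h0 : fderiv ℝ f z = 0 := IsLocalMin.fderiv_eq_zero (Eventually.of_forall hz)
  simp [Finset.sum_range_succ, iteratedFDeriv_one_apply, h0] at h
  rw [h]; ring

section

variable {d : ℕ} {Ω : Set (E d)} {H : Type*} [NormedAddCommGroup H] [InnerProductSpace ℝ H]
  [CompleteSpace H] [RKHS ℝ H Ω ℝ] {m : ℕ} {M D : ℝ}

/-- Taylor's formula with integral remainder: the gradient vanishes at `z`, and `integral_mem` puts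
the coefficients into `H`. At `z` the weight integrates to `1/2`, whence the factor `2`. -/
theorem RichRKHS.exists_quadratic_form (hH : RichRKHS H m M D) {f : E d → ℝ}
    (hf : ContDiff ℝ 2 f) (hfH : AnalyticAssumption H f) {z : Ω} (hz : IsGlobalMin f z) {ρ : ℝ}
    (hρ : 0 < ρ) (hball : Metric.ball (z : E d) ρ ⊆ Ω) :
    ∃ g : Fin d → Fin d → H, (∀ i j, g i j = g j i) ∧
      (∀ x : Ω, (x : E d) ∈ Metric.ball (z : E d) ρ →
        f x - f z = ∑ i, ∑ j, g i j x * ((x : E d) - z) i * ((x : E d) - z) j) ∧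
      ∀ v : E d, 2 * ∑ i, ∑ j, g i j z * v i * v j = iteratedFDeriv ℝ 2 f z ![v, v] := by
  choose u hu using hfH.second_mem
  choose g hg using fun i j => hH.integral_mem z ρ hρ hball (u i j)
  have hseg : ∀ x ∈ Metric.ball (z : E d) ρ, ∀ t ∈ Set.uIcc (0 : ℝ) 1, z + t • (x - z) ∈ Ω := by
    intro x hx t ht
    rw [Set.uIcc_of_le zero_le_one] at ht
    exact hball ((convex_ball _ _).add_smul_sub_mem (Metric.mem_ball_self hρ) hx ht)
  have hcont : ∀ i j, Continuous (partialDeriv ![i, j] f) := fun i j =>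
    (ContinuousMultilinearMap.apply ℝ (fun _ : Fin 2 => E d) ℝ
      fun k => EuclideanSpace.single (![i, j] k) 1).continuous.comp
      (hf.continuous_iteratedFDeriv (m := 2) le_rfl)
  have hgI : ∀ i j, ∀ x : Ω, (x : E d) ∈ Metric.ball (z : E d) ρ → g i j x =
      ∫ t in (0 : ℝ)..1, (1 - t) * partialDeriv ![i, j] f (z + t • ((x : E d) - z)) := by
    intro i j x hx
    rw [hg i j x hx]
    refine intervalIntegral.integral_congr fun t ht => ?_
    have h := extendZero_coe (fun y : Ω => u i j y) ⟨_, hseg x hx t ht⟩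
    simp only at h ⊢
    rw [h, hu]
  have hsym : ∀ (G : Fin d → Fin d → ℝ) (v : Fin d → ℝ),
      ∑ i, ∑ j, (1 / 2) * (G i j + G j i) * v i * v j = ∑ i, ∑ j, G i j * v i * v j := by
    intro G v
    have h : ∑ i, ∑ j, G j i * v i * v j = ∑ i, ∑ j, G i j * v i * v j := by
      rw [Finset.sum_comm]
      exact Finset.sum_congr rfl fun i _ => Finset.sum_congr rfl fun j _ => by ring
    calc _ = (1 / 2) * ∑ i, ∑ j, G i j * v i * v j + (1 / 2) * ∑ i, ∑ j, G j i * v i * v j := by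
          simp only [Finset.mul_sum, ← Finset.sum_add_distrib]
          exact Finset.sum_congr rfl fun i _ => Finset.sum_congr rfl fun j _ => by ring
      _ = _ := by rw [h]; ring
  -- Symmetrizing leaves the form unchanged and supplies the symmetry that `exists_ldl` needs.
  refine ⟨fun i j => (1 / 2 : ℝ) • (g i j + g j i), fun i j => by simp only [add_comm], fun x hx => ?_,
    fun v => ?_⟩
  · simp only [rkhs_smul_apply, rkhs_add_apply]
    rw [hsym (fun i j => g i j x)]
    have h := hz.sub_eq_integral hf ((x : E d) - z)
    rw [add_sub_cancel] at h
    have hi : ∀ i j, IntervalIntegrable (fun t : ℝ => (1 - t) *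
        (((x : E d) - z) i * ((x : E d) - z) j *
          partialDeriv ![i, j] f (z + t • ((x : E d) - z)))) MeasureTheory.volume 0 1 := by
      intro i j
      have := hcont i j
      exact Continuous.intervalIntegrable (by fun_prop) _ _
    have hi' : ∀ i, IntervalIntegrable (fun t : ℝ => ∑ j, (1 - t) *
        (((x : E d) - z) i * ((x : E d) - z) j *
          partialDeriv ![i, j] f (z + t • ((x : E d) - z)))) MeasureTheory.volume 0 1 :=
      fun i => Continuous.intervalIntegrable (continuous_finsetSum _ fun j _ => by
        have := hcont i j
        fun_prop) _ _
    rw [h]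
    simp only [iteratedFDeriv_two_self_eq_sum, Finset.mul_sum]
    rw [intervalIntegral.integral_finsetSum fun i _ => hi' i]
    refine Finset.sum_congr rfl fun i _ => ?_
    rw [intervalIntegral.integral_finsetSum fun j _ => hi i j]
    refine Finset.sum_congr rfl fun j _ => ?_
    rw [hgI i j x hx, mul_assoc, ← intervalIntegral.integral_mul_const]
    refine intervalIntegral.integral_congr fun t _ => ?_
    simp only
    ring
  · have hgz : ∀ i j, g i j z = (1 / 2) * partialDeriv ![i, j] f z := by
      intro i j
      rw [hgI i j z (Metric.mem_ball_self hρ)]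
      simp only [sub_self, smul_zero, add_zero]
      rw [intervalIntegral.integral_mul_const]
      congr 1
      rw [intervalIntegral.integral_sub (by simp) (by simp)]
      simp
      norm_num
    simp only [rkhs_smul_apply, rkhs_add_apply]
    rw [hsym (fun i j => g i j z), show (![v, v] : Fin 2 → E d) = fun _ => v from by
      ext i; fin_cases i <;> rfl, iteratedFDeriv_two_self_eq_sum, Finset.mul_sum]
    refine Finset.sum_congr rfl fun i _ => ?_
    rw [Finset.mul_sum]
    refine Finset.sum_congr rfl fun j _ => ?_
    rw [hgz]; ring

/-- Near a nondegenerate minimizer, `f` is a sum of `d` squares of functions of the space. -/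
theorem RichRKHS.exists_local_squares (hH : RichRKHS H m M D) (hΩ : IsOpen Ω) {f : E d → ℝ}
    (hG : GeometricAssumption Ω f) (hfH : AnalyticAssumption H f) {z : E d} (hzΩ : z ∈ Ω)
    (hz : IsGlobalMin f z) :
    ∃ w : Fin d → H, ∀ᶠ x : E d in 𝓝 z, ∀ hx : x ∈ Ω,
      f x - f z = ∑ i, (w i ⟨x, hx⟩) ^ 2 := by
  lift z to Ω using hzΩ
  obtain ⟨ρ, hρ, hball⟩ := Metric.isOpen_iff.1 hΩ z z.2
  obtain ⟨g, hgs, hgf, hgz⟩ := hH.exists_quadratic_form hG.contDiff hfH hz hρ hball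
  obtain ⟨l, hl⟩ := hH.exists_ldl hΩ z d g hgs fun v hv => by
    have h := hgz (WithLp.toLp 2 v)
    have h2 := hG.hessian_pos z z.2 hz (WithLp.toLp 2 v) (by simpa using hv)
    rw [← h] at h2
    simpa using h2
  choose p hp using fun j : Fin d => hH.smooth_mem (fun x => (x - (z : E d)) j) (by fun_prop)
  choose q hq _ using fun i j => hH.mul_mem (l i j) (p j)
  refine ⟨fun i => ∑ j, q i j, ?_⟩
  rw [nhds_subtype_eq_comap, eventually_comap] at hl
  filter_upwards [hl, Metric.ball_mem_nhds (z : E d) hρ] with x hlx hxb hx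
  rw [hgf ⟨x, hx⟩ hxb, hlx ⟨x, hx⟩ rfl fun j => (x - (z : E d)) j]
  simp only [rkhs_sum_apply, hq, hp]

end

/-! ### Rank one sums, cutoffs and the global sum of squares -/

section

variable {H : Type*} [NormedAddCommGroup H] [InnerProductSpace ℝ H] [CompleteSpace H]

/-- A finite sum of rank one operators `u ⟨u, ·⟩`. -/
theorem exists_isPositive_sum_rankOne {ι : Type} [Fintype ι] (u : ι → H) :
    ∃ A : H →L[ℝ] H, A.IsPositive ∧ (∀ y, inner ℝ y (A y) = ∑ i, inner ℝ (u i) y ^ 2) ∧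
      posTrace A ≠ ⊤ ∧ LinearMap.rank (A : H →ₗ[ℝ] H) ≤ (Fintype.card ι : ℕ) := by
  set A : H →L[ℝ] H := ∑ i, InnerProductSpace.rankOne ℝ (u i) (u i) with hA
  have happ : ∀ y, A y = ∑ i, inner ℝ (u i) y • u i := fun y => by
    simp [hA, sum_apply, InnerProductSpace.rankOne_apply]
  have hinner : ∀ y, inner ℝ y (A y) = ∑ i, inner ℝ (u i) y ^ 2 := by
    intro y
    rw [happ, inner_sum]
    refine Finset.sum_congr rfl fun i _ => ?_
    rw [inner_smul_right, real_inner_comm, sq]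
  refine ⟨A, ContinuousLinearMap.isPositive_sum _ fun i _ =>
    InnerProductSpace.isPositive_rankOne_self _, hinner, ?_, ?_⟩
  · obtain ⟨b, hb⟩ := (exists_hilbertBasis ℝ H).choose_spec
    have h : Summable fun e : (exists_hilbertBasis ℝ H).choose => inner ℝ (e : H) (A e) := by
      simp only [hinner]
      refine summable_sum fun i _ => (b.summable_inner_mul_inner (u i) (u i)).congr fun e => ?_
      rw [hb, real_inner_comm, sq, real_inner_comm]
    exact h.tsum_ofReal_ne_top
  · have hle : LinearMap.range (A : H →ₗ[ℝ] H) ≤ Submodule.span ℝ (Set.range u) := by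
      rintro _ ⟨y, rfl⟩
      rw [ContinuousLinearMap.coe_coe, happ]
      exact Submodule.sum_mem _ fun i _ =>
        Submodule.smul_mem _ _ (Submodule.subset_span ⟨i, rfl⟩)
    refine (Submodule.rank_mono hle).trans ((rank_span_le _).trans ?_)
    have := Cardinal.mk_range_le_lift (f := u)
    simpa using this

end

/-- Smooth cutoff functions near the points of a finite set, together with a remainder, whose
squares sum to one. -/
theorem exists_cutoffs {d : ℕ} {Z : Set (E d)} (hZ : Z.Finite) {ε : ℝ} (hε : 0 < ε)
    (hdisj : Z.Pairwise fun z w => Disjoint (Metric.ball z ε) (Metric.ball w ε)) :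
    ∃ (χ : E d → E d → ℝ) (χ₀ : E d → ℝ), (∀ z, ContDiff ℝ ∞ (χ z)) ∧ ContDiff ℝ ∞ χ₀ ∧
      (∀ z x, x ∉ Metric.ball z ε → χ z x = 0) ∧
      (∀ z ∈ Z, ∀ x ∈ Metric.ball z (ε / 2), χ₀ x = 0) ∧
      ∀ x, χ₀ x ^ 2 + ∑ z ∈ hZ.toFinset, χ z x ^ 2 = 1 := by
  let β : ∀ z : E d, ContDiffBump z := fun z => ⟨ε / 2, ε, half_pos hε, half_lt_self hε⟩
  have hβ0 : ∀ z x, x ∉ Metric.ball z ε → β z x = 0 := fun z x hx =>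
    (β z).zero_of_le_dist (not_lt.1 hx)
  have hβs : ∀ z, ContDiff ℝ ∞ fun x => β z x := fun z => (β z).contDiff
  have hother : ∀ z ∈ Z, ∀ w ∈ Z, w ≠ z → ∀ x ∈ Metric.ball z ε, β w x = 0 :=
    fun z hz w hw hne x hx => hβ0 w x fun h =>
      Set.disjoint_left.1 (hdisj hw hz hne) h hx
  have hsum : ∀ z ∈ Z, ∀ x ∈ Metric.ball z ε, ∑ w ∈ hZ.toFinset, β w x = β z x := by
    intro z hz x hx
    exact Finset.sum_eq_single z
      (fun w hw hne => hother z hz w (hZ.mem_toFinset.1 hw) hne x hx)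
      fun h => absurd (hZ.mem_toFinset.2 hz) h
  -- At each point at most one bump is nonzero, so `sin² + cos² = 1` gives the identity, and no
  -- square root has to be taken.
  refine ⟨fun z x => Real.sin (Real.pi / 2 * β z x),
    fun x => Real.cos (Real.pi / 2 * ∑ z ∈ hZ.toFinset, β z x),
    fun z => Real.contDiff_sin.comp (contDiff_const.mul (hβs z)),
    Real.contDiff_cos.comp (contDiff_const.mul (ContDiff.sum fun z _ => hβs z)),
    fun z x hx => by simp [hβ0 z x hx], fun z hz x hx => ?_, fun x => ?_⟩
  · simp only
    rw [hsum z hz x (Metric.ball_subset_ball (half_le_self hε.le) hx),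
      (β z).one_of_mem_closedBall (Metric.ball_subset_closedBall hx)]
    simp
  · by_cases h : ∃ z ∈ Z, x ∈ Metric.ball z ε
    · obtain ⟨z, hz, hx⟩ := h
      simp only [hsum z hz x hx]
      rw [Finset.sum_eq_single z
        (fun w hw hne => by simp [hother z hz w (hZ.mem_toFinset.1 hw) hne x hx])
        fun h => absurd (hZ.mem_toFinset.2 hz) h]
      exact Real.cos_sq_add_sin_sq _
    · push Not at h
      have h0 : ∀ z ∈ hZ.toFinset, β z x = 0 := fun z hz => hβ0 z x (h z (hZ.mem_toFinset.1 hz))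
      simp only
      rw [Finset.sum_eq_zero h0, Finset.sum_eq_zero fun z hz => by simp [h0 z hz]]
      simp

section

variable {d : ℕ} {Ω : Set (E d)} {H : Type*} [NormedAddCommGroup H] [InnerProductSpace ℝ H]
  [CompleteSpace H] [RKHS ℝ H Ω ℝ] {m : ℕ} {M D : ℝ}

/-- The closure of `Ω` minus the balls is compact and contains no global minimizer, the frontier
being free of them. -/
theorem GeometricAssumption.exists_pos_le_sub {f : E d → ℝ} (hG : GeometricAssumption Ω f)
    (hb : Bornology.IsBounded Ω) {z₀ : E d} (hz₀ : IsGlobalMin f z₀) {ε : ℝ} (hε : 0 < ε) :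
    ∃ δ > 0, ∀ x ∈ Ω, (∀ z ∈ Ω, IsGlobalMin f z → x ∉ Metric.ball z ε) → δ ≤ f x - f z₀ := by
  set K : Set (E d) := closure Ω \ ⋃ z ∈ {z ∈ Ω | IsGlobalMin f z}, Metric.ball z ε with hK
  have hKc : IsCompact K := hb.isCompact_closure.diff
    (isOpen_biUnion fun _ _ => Metric.isOpen_ball)
  have hpos : ∀ x ∈ K, 0 < f x - f z₀ := by
    intro x hx
    by_contra hle
    have hmin : IsGlobalMin f x := fun y => by have := hz₀ y; linarith
    by_cases hxΩ : x ∈ Ω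
    · exact hx.2 (Set.mem_biUnion (show x ∈ {z ∈ Ω | IsGlobalMin f z} from ⟨hxΩ, hmin⟩)
        (Metric.mem_ball_self hε))
    · exact hG.boundary x ⟨hx.1, fun h => hxΩ (interior_subset h)⟩ hmin
  have hmem : ∀ x ∈ Ω, (∀ z ∈ Ω, IsGlobalMin f z → x ∉ Metric.ball z ε) → x ∈ K := by
    intro x hx h
    refine ⟨subset_closure hx, fun hx2 => ?_⟩
    obtain ⟨z, hz, hxz⟩ := Set.mem_iUnion₂.1 hx2
    exact h z hz.1 hz.2 hxz
  rcases K.eq_empty_or_nonempty with he | hne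
  · exact ⟨1, one_pos, fun x hx h => by have := hmem x hx h; simp [he] at this⟩
  · obtain ⟨y, hy, hmin⟩ := hKc.exists_isMinOn hne
      hG.contDiff.continuous.continuousOn
    exact ⟨_, hpos y hy, fun x hx h => sub_le_sub_right (hmin (hmem x hx h)) _⟩

/-- Multiply `f - f z₀` by `χ₀² + ∑ χ_z² = 1`. Each `χ_z` multiplies the `d` local squares at `z`,
and the remainder is a single square; this accounts for the index type and for the rank. -/
theorem RichRKHS.exists_sum_squares (hH : RichRKHS H m M D) (hΩ : IsOpen Ω)
    (hb : Bornology.IsBounded Ω) {f : E d → ℝ} (hG : GeometricAssumption Ω f)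
    (hfH : AnalyticAssumption H f) {z₀ : E d} (hz₀ : IsGlobalMin f z₀) :
    ∃ u : Option (Fin d × {z ∈ Ω | IsGlobalMin f z}) → H,
      ∀ x : Ω, f x - f z₀ = ∑' i, u i x ^ 2 := by
  set Z : Set (E d) := {z ∈ Ω | IsGlobalMin f z} with hZdef
  have hZ : Z.Finite := hG.finite_minimizers
  have := hZ.fintype
  have hfz : ∀ z ∈ Z, f z = f z₀ := fun z hz => le_antisymm (hz.2 z₀) (hz₀ z)
  choose! w hw using fun (z : E d) (hz : z ∈ Z) => hH.exists_local_squares hΩ hG hfH hz.1 hz.2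
  obtain ⟨ε, ⟨hεw, hεd⟩, hε⟩ : ∃ ε : ℝ, ((∀ z ∈ Z, ∀ x ∈ Metric.ball z ε, ∀ hx : x ∈ Ω,
      f x - f z = ∑ i, (w z i ⟨x, hx⟩) ^ 2) ∧
      ∀ z ∈ Z, ∀ y ∈ Z, z ≠ y → Disjoint (Metric.ball z ε) (Metric.ball y ε)) ∧ 0 < ε := by
    have h1 : ∀ᶠ ε : ℝ in 𝓝[>] 0, ∀ z ∈ Z, ∀ x ∈ Metric.ball z ε, ∀ hx : x ∈ Ω,
        f x - f z = ∑ i, (w z i ⟨x, hx⟩) ^ 2 := by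
      refine (eventually_all_finite hZ).2 fun z hz => ?_
      obtain ⟨ρ, hρ, h⟩ := Metric.eventually_nhds_iff_ball.1 (hw z hz)
      filter_upwards [Ioo_mem_nhdsGT hρ] with ε hε x hx
      exact h x (Metric.ball_subset_ball hε.2.le hx)
    have h2 : ∀ᶠ ε : ℝ in 𝓝[>] 0, ∀ z ∈ Z, ∀ y ∈ Z, z ≠ y →
        Disjoint (Metric.ball z ε) (Metric.ball y ε) := by
      refine (eventually_all_finite hZ).2 fun z _ => (eventually_all_finite hZ).2 fun y _ => ?_
      rcases eq_or_ne z y with rfl | hne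
      · exact Eventually.of_forall fun _ h => absurd rfl h
      · filter_upwards [Ioo_mem_nhdsGT (half_pos (dist_pos.2 hne))] with ε hε _
        exact Metric.ball_disjoint_ball (by linarith [hε.2])
    exact ((h1.and h2).and self_mem_nhdsWithin).exists
  obtain ⟨χ, χ₀, hχs, hχ₀s, hχ, hχ₀, hsum⟩ := exists_cutoffs hZ hε fun z hz y hy => hεd z hz y hy
  obtain ⟨δ, hδ, hδf⟩ := hG.exists_pos_le_sub hb hz₀ (half_pos hε)
  obtain ⟨s, hs, hs2⟩ := exists_smooth_inv_sqrt hδ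
  obtain ⟨F₀, hF₀⟩ := hfH.mem
  obtain ⟨F, hF⟩ := hH.exists_comp (s := fun t => t - f z₀) (by fun_prop) F₀
  obtain ⟨S, hS⟩ := hH.exists_comp hs F
  obtain ⟨Q, hQ, _⟩ := hH.mul_mem F S
  obtain ⟨p₀, hp₀⟩ := hH.smooth_mem χ₀ hχ₀s
  obtain ⟨u₀, hu₀, _⟩ := hH.mul_mem p₀ Q
  choose p hp using fun z => hH.smooth_mem (χ z) (hχs z)
  choose u hu _ using fun z i => hH.mul_mem (p z) (w z i)
  refine ⟨fun o => o.elim u₀ fun iz => u iz.2 iz.1, fun x => ?_⟩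
  rw [tsum_fintype, Fintype.sum_option, Fintype.sum_prod_type_right]
  simp only [Option.elim]
  -- Here `u₀ = χ₀ F s(F)` with `F = f - f z₀`. Where `F ≥ δ` one has `s(F)² F = 1`; on the balls of
  -- radius `ε / 2`, outside of which this bound holds, `χ₀` vanishes.
  have h1 : u₀ x ^ 2 = χ₀ x ^ 2 * (f x - f z₀) := by
    rw [hu₀, hQ, hp₀, hS, hF, hF₀]
    by_cases h : ∃ z ∈ Z, (x : E d) ∈ Metric.ball z (ε / 2)
    · obtain ⟨z, hz, hxz⟩ := h
      rw [hχ₀ z hz x hxz]; ring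
    · push Not at h
      have := hs2 _ (hδf x x.2 fun z hz hzm => h z ⟨hz, hzm⟩)
      linear_combination (χ₀ x ^ 2 * (f x - f z₀)) * this
  have h2 : ∀ z : Z, ∑ i, u z i x ^ 2 = χ z x ^ 2 * (f x - f z₀) := by
    intro z
    simp only [hu, hp, mul_pow, ← Finset.mul_sum]
    by_cases h : (x : E d) ∈ Metric.ball (z : E d) ε
    · rw [← hεw z z.2 x h x.2, hfz z z.2]
    · simp [hχ z x h]
  simp only [h1, h2, ← Finset.sum_mul, ← add_mul]
  have h3 := hsum x
  rw [Finset.sum_subtype hZ.toFinset fun z => hZ.mem_toFinset] at h3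
  rw [h3, one_mul]

theorem exists_optimal_of_assumptions (hΩ : IsOpen Ω)
    (hb : Bornology.IsBounded Ω) (hH : RichRKHS H m M D) {f : E d → ℝ}
    (hG : GeometricAssumption Ω f) (hfH : AnalyticAssumption H f) :
    IsLeast (Set.range f) (infOn Ω f) ∧
      ∃ A : H →L[ℝ] H, IsOptimal f (infOn Ω f) A ∧ posTrace A ≠ ⊤ ∧
        LinearMap.rank (A : H →ₗ[ℝ] H) ≤ (d * {z ∈ Ω | IsGlobalMin f z}.ncard + 1 : ℕ) := by
  obtain ⟨z₀, hz₀Ω, hz₀⟩ := hG.exists_minimizer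
  have hinf : infOn Ω f = f z₀ := by
    have : Nonempty Ω := ⟨⟨z₀, hz₀Ω⟩⟩
    exact le_antisymm (ciInf_le ⟨f z₀, by rintro _ ⟨y, rfl⟩; exact hz₀ y⟩ (⟨z₀, hz₀Ω⟩ : Ω))
      (le_ciInf fun y => hz₀ y)
  rw [hinf]
  refine ⟨⟨⟨z₀, rfl⟩, by rintro _ ⟨y, rfl⟩; exact hz₀ y⟩, ?_⟩
  have hfin := hG.finite_minimizers
  have := hfin.fintype
  obtain ⟨u, hu⟩ := hH.exists_sum_squares hΩ hb hG hfH hz₀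
  let e := Fintype.equivFin (Option (Fin d × {z ∈ Ω | IsGlobalMin f z}))
  obtain ⟨A, hA, hAu, hAt, hAr⟩ := exists_isPositive_sum_rankOne fun i => u (e.symm i)
  refine ⟨A, ⟨⟨hA, fun x => ?_⟩, fun c A' h => ?_⟩, hAt, hAr.trans ?_⟩
  · rw [hAu, hu, tsum_fintype, ← e.symm.sum_comp]
    simp only [inner_feature]
  -- Feasibility at the minimizer already forces the competing value to be at most `f z₀`.
  · have h1 := h.2 ⟨z₀, hz₀Ω⟩
    have h2 := h.1.inner_nonneg_right (feature H (⟨z₀, hz₀Ω⟩ : Ω))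
    simp only at h1
    linarith
  · rw [Fintype.card_fin, Fintype.card_option, Fintype.card_prod, Fintype.card_fin,
      Set.fintypeCard_eq_ncard]

end

end KernelSOS

/-! ### The main theorem -/

theorem mainTheorem10 {d : ℕ} (hd : 0 < d) {Ω : Set (E d)} {r : ℝ} (hr : 0 < r)
    (hΩ : IsUnionOfBalls Ω r)
    {H : Type*} [NormedAddCommGroup H] [InnerProductSpace ℝ H] [CompleteSpace H] [RKHS ℝ H Ω ℝ]
    {m : ℕ} (hm : 0 < m) {M D : ℝ} (hH : RichRKHS H m M D)
    {n : ℕ} (hn : 0 < n) (x : Fin n → Ω) (hx : Function.Injective x)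
    (R : Matrix (Fin n) (Fin n) ℝ) (hR : IsCholesky (kernelMatrix H x) R)
    (f : E d → ℝ) {lam : ℝ} (hlam : 0 < lam)
    (hfill : fillDistance x ≤ r / max 1 (18 * ((m : ℝ) - 1) ^ 2))
    {η : ℝ} (hη : η = C₀ d m * fillDistance x ^ m) (hlamη : 2 * M * D * η ≤ lam) :
    -- under the assumptions on `f`, the minimum of `f` is `f_*` and an operator `A_*` exists
    (GeometricAssumption Ω f → AnalyticAssumption H f →
      IsLeast (Set.range f) (infOn Ω f) ∧
      ∃ A : H →L[ℝ] H, IsOptimal f (infOn Ω f) A ∧ posTrace A ≠ ⊤ ∧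
        LinearMap.rank (A : H →ₗ[ℝ] H) ≤ (d * {z ∈ Ω | IsGlobalMin f z}.ncard + 1 : ℕ)) ∧
    -- the bounds hold for every trace-class operator `A_*` that represents `f - f_*`
    ∀ A : H →L[ℝ] H, IsFeasible f (infOn Ω f) A → posTrace A ≠ ⊤ →
      -- `|f|_{Ω,m}` is well defined and finite
      ContDiffOn ℝ m f Ω ∧
      (∀ ι : Fin m → Fin d, BddAbove (Set.range fun z : Ω => |partialDeriv ι f z|)) ∧
      -- the finite-dimensional problem admits a solution
      IsGreatest (objectiveValues R (fun i => f (x i)) lam)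
        (optimalValue R (fun i => f (x i)) lam) ∧
      -- error of approximate solutions
      ∀ (θ₁ θ₂ τ₁ τ₂ : ℝ), 0 ≤ θ₁ → 0 ≤ θ₂ → 0 ≤ τ₁ → 0 ≤ τ₂ → θ₂ ≤ lam / 8 → τ₂ ≤ lam / 8 →
        ∀ (c : ℝ) (B : Matrix (Fin n) (Fin n) ℝ),
          IsApproxSolution R (fun i => f (x i)) lam θ₁ θ₂ τ₁ τ₂ c B →
          |c - infOn Ω f| ≤ 7 * (2 * τ₁ + η * seminormOn Ω m f)
              + 6 * (θ₁ + lam * (posTrace A).toReal) ∧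
          B.trace ≤ 8 * (posTrace A).toReal + 8 * (η / lam) * seminormOn Ω m f
              + 8 * ((θ₁ + 2 * τ₁) / lam) := by
  have hO := hΩ.isOpen
  refine ⟨fun hG hfH => exists_optimal_of_assumptions hO hΩ.isBounded hH hG hfH,
    fun A hA hfin => ?_⟩
  obtain ⟨v, hv, hvx⟩ := exists_orthonormal_feature_eq hH hx hR
  obtain ⟨hf, hbdd⟩ := contDiffOn_of_isFeasible hΩ hr hm hH hA
  obtain ⟨B₀, hB₀, hfB₀, -⟩ := exists_compression hv hvx hA hfin
  have hopt := isGreatest_objectiveValues hn R (fun i => f (x i)) hlam ⟨_, _, B₀, hB₀, hfB₀, rfl⟩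
  exact ⟨hf, hbdd, hopt, fun θ₁ θ₂ τ₁ τ₂ hθ₁ _ hτ₁ _ hθ₂ hτ₂ c B hB =>
    approximate_solution_bounds hd hr hΩ hm hH hn x hv hvx f hlam hfill hη hlamη hA hfin hopt
      hθ₁ hτ₁ hθ₂ hτ₂ hB⟩
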